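/- There is an absolute constant $C>0$ such that the following holds. Let $m\ge 1$, $k\ge 1$ and $n_1,\dots,n_k\ge m$ be integers, and put $N=n_1+\cdots+n_k$. Let $P$ be a probability distribution on $\mathbb{R}$, and let $h:\mathbb{R}^m\to\mathbb{R}$ be a measurable symmetric function. For $X_1,\dots,X_m$ i.i.d. with law $P$, assume $\mathbb{E}\,h(X_1,\dots,X_m)^4<\infty$ and put $$\theta=\mathbb{E}\,h(X_1,\dots,X_m),\qquad g(x)=\mathbb{E}[h(X_1,\dots,X_m)-\theta\mid X_1=x],\qquad \sigma_1=\big(\mathbb{E}\,g(X_1)^2\big)^{1/2},\qquad \|h\|_4=\big(\mathbb{E}|h(X_1,\dots,X_m)|^4\big)^{1/4}.$$ Assume $\sigma_1>0$. Let $X_{ij}$ ($1\le i\le k$, $1\le j\le n_i$) be independent random variables with common law $P$, that is, a sample of size $N$ partitioned into $k$ blocks of sizes $n_1,\dots,n_k$, and let $$U_d=\sum_{i=1}^{k}\frac{n_i}{N}\binom{n_i}{m}^{-1}\sum_{1\le j_1<\cdots<j_m\le n_i}h(X_{ij_1},\dots,X_{ij_m}),\qquad W=\frac{\sqrt N}{m\sigma_1}\,(U_d-\theta).$$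 Then, with $\Phi$ the standard normal distribution function, $$\sup_{z\in\mathbb{R}}\left|\mathbb{P}\left(\frac{W}{\sqrt{\operatorname{Var}(W)}}\le z\right)-\Phi(z)\right|\le\frac{Cm}{\sqrt N}\cdot\frac{\|h\|_4^3}{\sigma_1^3}.$$ -/

import Mathlib

open MeasureTheory ProbabilityTheory

noncomputable section

namespace DistributedUStat

/-- A kernel `h : ℝ^m → ℝ` is symmetric if it is invariant under permutations of its arguments. -/
def IsSymmetricKernel {m : ℕ} (h : (Fin m → ℝ) → ℝ) : Prop :=
  ∀ (π : Equiv.Perm (Fin m)) (x : Fin m → ℝ), h (x ∘ π) = h x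

/-- The joint law of `(X_1, …, X_m)`, where the `X_i` are i.i.d. with law `P`. -/
def iidLaw (m : ℕ) (P : Measure ℝ) : Measure (Fin m → ℝ) := Measure.pi fun _ => P

/-- `θ = E h(X_1, …, X_m)`. -/
def theta {m : ℕ} (P : Measure ℝ) (h : (Fin m → ℝ) → ℝ) : ℝ := ∫ y, h y ∂(iidLaw m P)

/-- `‖h‖_p = (E |h(X_1, …, X_m)|^p)^(1/p)`. -/
def kernelNorm {m : ℕ} (P : Measure ℝ) (h : (Fin m → ℝ) → ℝ) (p : ℕ) : ℝ :=
  (∫ y, |h y| ^ p ∂(iidLaw m P)) ^ (1 / (p : ℝ))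

/-- `g(x) = E[h(X_1, …, X_m) - θ | X_1 = x] = E[h(x, X_2, …, X_m) - θ]`. That this is a version of
the conditional expectation is `projection_ae_eq_condExp` below. -/
def projection {m : ℕ} [NeZero m] (P : Measure ℝ) (h : (Fin m → ℝ) → ℝ) (x : ℝ) : ℝ :=
  ∫ y, (h (Function.update y 0 x) - theta P h) ∂(iidLaw m P)

/-- `σ₁ = (E g(X_1)^2)^(1/2)`. -/
def sigmaOne {m : ℕ} [NeZero m] (P : Measure ℝ) (h : (Fin m → ℝ) → ℝ) : ℝ :=
  √(∫ x, projection P h x ^ 2 ∂P)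

open Classical in
/-- The U-statistic of the observations `x_1, …, x_n`: the average of `h(x_{j_1}, …, x_{j_m})` over
all `1 ≤ j_1 < ⋯ < j_m ≤ n`. -/
def uStat {m n : ℕ} (h : (Fin m → ℝ) → ℝ) (x : Fin n → ℝ) : ℝ :=
  ((n.choose m : ℕ) : ℝ)⁻¹ * ∑ j : Fin m → Fin n with StrictMono j, h (fun l => x (j l))

/-- The total sample size `N = n_1 + ⋯ + n_k`. -/
def totalSize {k : ℕ} (n : Fin k → ℕ) : ℕ := ∑ i, n i

/-- The distributed U-statistic `U_d = N⁻¹ ∑_i n_i U_{N,i}` of a sample split into `k` blocks, the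
`i`-th one being `x i 0, …, x i (n i - 1)`. -/
def distributedUStat {m k : ℕ} {n : Fin k → ℕ} (h : (Fin m → ℝ) → ℝ)
    (x : (i : Fin k) → Fin (n i) → ℝ) : ℝ :=
  1 / (totalSize n : ℝ) * ∑ i, (n i : ℝ) * uStat h (x i)

/-- `W = √N / (m σ₁) * (U_d - θ)`, as a function of the sample point `ω`. -/
def normalizedStat {Ω : Type*} {m k : ℕ} [NeZero m] {n : Fin k → ℕ} (P : Measure ℝ)
    (h : (Fin m → ℝ) → ℝ) (X : (i : Fin k) → Fin (n i) → Ω → ℝ) (ω : Ω) : ℝ :=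
  √(totalSize n : ℝ) / ((m : ℝ) * sigmaOne P h) *
    (distributedUStat h (fun i j => X i j ω) - theta P h)

/-- The standard normal distribution function. -/
def Phi (z : ℝ) : ℝ := cdf (gaussianReal 0 1) z

instance {m : ℕ} (P : Measure ℝ) [IsProbabilityMeasure P] : IsProbabilityMeasure (iidLaw m P) := by
  unfold iidLaw; infer_instance

lemma measurePreserving_update {m : ℕ} [NeZero m] (P : Measure ℝ) [IsProbabilityMeasure P] :
    MeasurePreserving (fun p : ℝ × (Fin m → ℝ) => Function.update p.2 0 p.1)
      (P.prod (iidLaw m P)) (iidLaw m P) := by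
  have hmeas : Measurable (fun p : ℝ × (Fin m → ℝ) => Function.update p.2 0 p.1) := by
    refine measurable_pi_lambda _ fun i => ?_
    by_cases hi : i = 0
    · subst hi; simpa using measurable_fst
    · simp only [Function.update_of_ne hi]
      exact (measurable_pi_apply i).comp measurable_snd
  refine ⟨hmeas, ?_⟩
  unfold iidLaw
  symm
  refine Measure.pi_eq fun s hs => ?_
  rw [Measure.map_apply hmeas (MeasurableSet.univ_pi hs)]
  have hpre : (fun p : ℝ × (Fin m → ℝ) => Function.update p.2 0 p.1) ⁻¹' (Set.univ.pi s)
      = (s 0) ×ˢ (Set.univ.pi (Function.update s 0 Set.univ)) := by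
    ext p
    simp only [Set.mem_preimage, Set.mem_pi, Set.mem_univ, true_implies, Set.mem_prod]
    constructor
    · intro hp
      refine ⟨by simpa using hp 0, fun i => ?_⟩
      by_cases hi : i = 0
      · subst hi; simp
      · simpa [Function.update_of_ne hi] using hp i
    · rintro ⟨h0, hp⟩ i
      by_cases hi : i = 0
      · subst hi; simpa using h0
      · simpa [Function.update_of_ne hi] using hp i
  rw [hpre, Measure.prod_prod, Measure.pi_pi,
    ← Finset.mul_prod_erase Finset.univ (fun i => P (s i)) (Finset.mem_univ 0),
    ← Finset.mul_prod_erase Finset.univ (fun i => P (Function.update s 0 Set.univ i))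
      (Finset.mem_univ 0)]
  simp only [Function.update_self, measure_univ, one_mul]
  congr 1
  refine Finset.prod_congr rfl fun i hi => ?_
  rw [Function.update_of_ne (Finset.ne_of_mem_erase hi)]

/-- `g(X_1) = E[h(X_1, …, X_m) - θ | X_1]` almost surely. -/
lemma projection_ae_eq_condExp {m : ℕ} [NeZero m] (P : Measure ℝ) [IsProbabilityMeasure P]
    (h : (Fin m → ℝ) → ℝ) (hh : Measurable h) (hint : Integrable h (iidLaw m P)) :
    (fun y : Fin m → ℝ => projection P h (y 0)) =ᵐ[iidLaw m P]
      (iidLaw m P)[fun y => h y - theta P h |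
        MeasurableSpace.comap (fun y : Fin m → ℝ => y 0) inferInstance] := by
  have hU := measurePreserving_update (m := m) P
  have hm0 : Measurable (fun y : Fin m → ℝ => y 0) := measurable_pi_apply 0
  have hev : MeasurePreserving (fun y : Fin m → ℝ => y 0) (iidLaw m P) P :=
    measurePreserving_eval (fun _ => P) 0
  have hI : Integrable (fun y => h y - theta P h) (iidLaw m P) :=
    hint.sub (integrable_const _)
  have hI2 : Integrable (fun p : ℝ × (Fin m → ℝ) =>
      h (Function.update p.2 0 p.1) - theta P h) (P.prod (iidLaw m P)) :=
    hU.integrable_comp_of_integrable hI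
  have hgm : StronglyMeasurable (projection P h) := by
    unfold projection
    refine StronglyMeasurable.integral_prod_right' (ν := iidLaw m P)
      (f := fun p : ℝ × (Fin m → ℝ) => h (Function.update p.2 0 p.1) - theta P h) ?_
    exact ((hh.comp hU.measurable).sub_const _).stronglyMeasurable
  have hgi : Integrable (projection P h) P := hI2.integral_prod_left
  have hgi' : Integrable (fun y : Fin m → ℝ => projection P h (y 0)) (iidLaw m P) :=
    hev.integrable_comp_of_integrable hgi
  refine ae_eq_condExp_of_forall_setIntegral_eq hm0.comap_le hI
    (fun s _ _ => hgi'.integrableOn) ?_ ?_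
  · rintro s ⟨t, ht, rfl⟩ -
    have h1 : ∫ y in (fun y : Fin m → ℝ => y 0) ⁻¹' t, projection P h (y 0) ∂(iidLaw m P)
        = ∫ x in t, projection P h x ∂P := by
      have := setIntegral_map (μ := iidLaw m P) (g := fun y : Fin m → ℝ => y 0)
        (f := projection P h) ht hgm.aestronglyMeasurable hm0.aemeasurable
      rw [hev.map_eq] at this
      exact this.symm
    have h2 := setIntegral_map (μ := P.prod (iidLaw m P))
      (g := fun p : ℝ × (Fin m → ℝ) => Function.update p.2 0 p.1)
      (f := fun y => h y - theta P h) (hm0 ht)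
      ((hh.sub_const _).aestronglyMeasurable) hU.measurable.aemeasurable
    rw [hU.map_eq] at h2
    have hpre : (fun p : ℝ × (Fin m → ℝ) => Function.update p.2 0 p.1) ⁻¹'
        ((fun y : Fin m → ℝ => y 0) ⁻¹' t) = t ×ˢ Set.univ := by
      ext p; simp
    rw [h1, h2, hpre, setIntegral_prod _ hI2.integrableOn]
    simp [projection]
  · exact (hgm.comp_measurable (comap_measurable _)).aestronglyMeasurable

end DistributedUStat

end

/-! The distributed statistic is a weighted sum of `h` over index tuples inside blocks. The factor
`n_i / N` exactly offsets the block-dependent share of tuples through an index, so each observation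
carries the same total weight `m / N` (`sum_blockWeight`). After that the blocks play no role, and
the bound holds for any nonnegative weighted U-statistic with this property
(`weightedUStat_berryEsseen`).

The normal approximation is Stein's method for a standardized function `F` of independent variables.
Take an independent copy of the sample. Let `Δ_i` be the change of `F` when coordinate `i` is
replaced, and `D_i` the `i`-th increment on the path that replaces the coordinates one after
another. Telescoping and exchangeability of the two copies give `E[F φ] = ½ ∑ E[D_i Δ_i φ]`, where
`Δ_i φ` denotes the increment of `φ` (`integral_mul_eq_sum_pathDiff`). For `φ = f(F)`, with `f` the
Stein solution for the half-line up to `z`, the main term is governed by `1 - ½ ∑ D_i Δ_i`, which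
has mean zero.

The Taylor remainder of the nonsmooth `f` is handled by monotonicity instead of concentration: it is
at most `(a - b)(g(a) - g(b))` with `g(w) = w f(w) - 1{w ≤ z}` and `|g| ≤ 2`
(`abs_steinSol_sub_le`). Exchanging the copies turns the sum of remainders into the expectation of
`g(F) ∑ |D_i| Δ_i`, and `∑ |D_i| Δ_i` is again centred. The error is therefore at most a constant
times the standard deviations of `∑ ψ(D_i) Δ_i` for the two 1-Lipschitz choices `ψ = id` and `ψ =
|·|`.

Efron–Stein on the space of pairs bounds these deviations through the fourth moments of first- and
second-order differences of `F` (`variance_pairSum_le`). For a weighted U-statistic, the first-order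
differences and the row sums of the second-order ones are of order `m‖h‖₄ / N` and `m²‖h‖₄ / N`
before standardization. The Hájek projection bounds the standard deviation below by `m σ₁ / √N`.
This yields `m (‖h‖₄ / σ₁)² / √N`, and `σ₁ ≤ ‖h‖₄` allows the cube. -/

namespace DistributedUStat

/-! ### Mills ratio estimates and the Stein equation for half-lines -/

section GaussianStein

open Filter Topology Set

/-- The standard normal density. -/
noncomputable def gaussDensity (x : ℝ) : ℝ := gaussianPDFReal 0 1 x

lemma gaussDensity_pos (x : ℝ) : 0 < gaussDensity x :=
  gaussianPDFReal_pos 0 1 x one_ne_zero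

lemma gaussDensity_eq (x : ℝ) :
    gaussDensity x = (√(2 * Real.pi))⁻¹ * Real.exp (-x ^ 2 / 2) := by
  simp [gaussDensity, gaussianPDFReal]

lemma gaussDensity_neg (x : ℝ) : gaussDensity (-x) = gaussDensity x := by
  simp [gaussDensity_eq]

lemma hasDerivAt_gaussDensity (x : ℝ) : HasDerivAt gaussDensity (-x * gaussDensity x) x := by
  have h1 : HasDerivAt (fun y : ℝ => -y ^ 2 / 2) (-x) x := by
    have := ((hasDerivAt_pow 2 x).neg).div_const 2
    convert! this using 1
    simp; ring
  have h2 := (h1.exp).const_mul (√(2 * Real.pi))⁻¹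
  have h3 : gaussDensity = fun y => (√(2 * Real.pi))⁻¹ * Real.exp (-y ^ 2 / 2) :=
    funext gaussDensity_eq
  rw [gaussDensity_eq, h3]
  convert! h2 using 1
  ring

lemma integrable_gaussDensity : Integrable gaussDensity := integrable_gaussianPDFReal 0 1

lemma Phi_eq_integral (z : ℝ) : Phi z = ∫ x in Iic z, gaussDensity x := by
  rw [Phi, cdf_eq_real, measureReal_def, gaussianReal_apply_eq_integral 0 one_ne_zero,
    ENNReal.toReal_ofReal]
  · rfl
  · exact integral_nonneg fun x => gaussianPDFReal_nonneg 0 1 x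

lemma hasDerivAt_Phi (z : ℝ) : HasDerivAt Phi (gaussDensity z) z := by
  have hc : Continuous gaussDensity :=
    continuous_iff_continuousAt.2 fun x => (hasDerivAt_gaussDensity x).continuousAt
  have h1 : ∀ y, Phi y = Phi 0 + ∫ x in (0 : ℝ)..y, gaussDensity x := by
    intro y
    rw [← intervalIntegral.integral_Iic_sub_Iic integrable_gaussDensity.integrableOn
      integrable_gaussDensity.integrableOn, Phi_eq_integral, Phi_eq_integral]
    ring
  have h2 : Phi = fun y => Phi 0 + ∫ x in (0 : ℝ)..y, gaussDensity x := funext h1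
  rw [h2]
  exact (intervalIntegral.integral_hasDerivAt_right (hc.intervalIntegrable _ _)
    (hc.stronglyMeasurableAtFilter _ _) hc.continuousAt).const_add _

lemma Phi_neg (z : ℝ) : Phi (-z) = 1 - Phi z := by
  have h1 : ∫ x, gaussDensity x = 1 := integral_gaussianPDFReal_eq_one 0 one_ne_zero
  have h2 := intervalIntegral.integral_Iic_add_Ioi (b := z) (f := gaussDensity) (μ := volume)
    integrable_gaussDensity.integrableOn integrable_gaussDensity.integrableOn
  have h3 : ∫ x in Iic (-z), gaussDensity x = ∫ x in Ioi z, gaussDensity x := by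
    rw [← integral_comp_neg_Ioi]
    simp [gaussDensity_neg]
  rw [Phi_eq_integral, Phi_eq_integral, h3]
  linarith

lemma Phi_nonneg (z : ℝ) : 0 ≤ Phi z := cdf_nonneg _ _

lemma Phi_le_one (z : ℝ) : Phi z ≤ 1 := cdf_le_one _ _

lemma tendsto_Phi_atBot : Tendsto Phi atBot (𝓝 0) := tendsto_cdf_atBot _

lemma tendsto_gaussDensity_atBot : Tendsto gaussDensity atBot (𝓝 0) := by
  have h3 : gaussDensity = fun y => (√(2 * Real.pi))⁻¹ * Real.exp (-y ^ 2 / 2) :=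
    funext gaussDensity_eq
  rw [h3]
  have : Tendsto (fun y : ℝ => Real.exp (-y ^ 2 / 2)) atBot (𝓝 0) := by
    refine Real.tendsto_exp_atBot.comp ?_
    have h4 : Tendsto (fun y : ℝ => y ^ 2) atBot atTop := by
      have := (tendsto_pow_atTop (α := ℝ) (n := 2) two_ne_zero).comp tendsto_neg_atBot_atTop
      refine this.congr fun y => by simp
    exact (tendsto_neg_atTop_atBot.comp h4).atBot_div_const two_pos
  simpa using this.const_mul (√(2 * Real.pi))⁻¹

/-- The lower Mills ratio `Φ / φ`. -/
noncomputable def millsRatio (x : ℝ) : ℝ := Phi x / gaussDensity x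

lemma millsRatio_nonneg (x : ℝ) : 0 ≤ millsRatio x :=
  div_nonneg (Phi_nonneg x) (gaussDensity_pos x).le

lemma hasDerivAt_millsRatio (x : ℝ) : HasDerivAt millsRatio (1 + x * millsRatio x) x := by
  have hp := (gaussDensity_pos x).ne'
  have h := (hasDerivAt_Phi x).div (hasDerivAt_gaussDensity x) hp
  convert! h using 1
  unfold millsRatio
  field_simp
  ring

/-- The lower Gaussian tail bound: the difference of the two sides vanishes at `-∞` and has
nonnegative derivative. -/
lemma neg_div_le_Phi (x : ℝ) : -(x * gaussDensity x / (1 + x ^ 2)) ≤ Phi x := by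
  have hd : ∀ y : ℝ, HasDerivAt (fun y => Phi y + y * gaussDensity y / (1 + y ^ 2))
      (gaussDensity y * (2 / (1 + y ^ 2) ^ 2)) y := by
    intro y
    have hne : (1 + y ^ 2 : ℝ) ≠ 0 := by positivity
    have h := (hasDerivAt_Phi y).add
      (((hasDerivAt_id y).mul (hasDerivAt_gaussDensity y)).div
        ((hasDerivAt_pow 2 y).const_add 1) hne)
    convert! h using 1
    simp
    field_simp
    ring
  have hmono : Monotone (fun y => Phi y + y * gaussDensity y / (1 + y ^ 2)) := by
    refine monotone_of_deriv_nonneg (fun y => (hd y).differentiableAt) fun y => ?_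
    rw [(hd y).deriv]
    have := gaussDensity_pos y
    positivity
  have hlim : Tendsto (fun y => Phi y + y * gaussDensity y / (1 + y ^ 2)) atBot (𝓝 0) := by
    have h2 : Tendsto (fun y => y * gaussDensity y / (1 + y ^ 2)) atBot (𝓝 0) := by
      refine squeeze_zero_norm (fun y => ?_) tendsto_gaussDensity_atBot
      have hp := gaussDensity_pos y
      rw [Real.norm_eq_abs, abs_div, abs_mul, abs_of_pos hp,
        abs_of_pos (show (0 : ℝ) < 1 + y ^ 2 by positivity), div_le_iff₀ (by positivity)]
      have : |y| ≤ 1 + y ^ 2 := by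
        rw [← sq_abs]; nlinarith [sq_nonneg (|y| - 1), abs_nonneg y]
      nlinarith
    simpa using tendsto_Phi_atBot.add h2
  have := hmono.le_of_tendsto hlim x
  linarith

/-- The derivative is `(1 + y²) M(y) + y` with `M = Φ / φ`, and its nonnegativity is exactly
`neg_div_le_Phi`. -/
lemma monotone_mul_millsRatio : Monotone fun x => x * millsRatio x := by
  have hd : ∀ y : ℝ, HasDerivAt (fun y => y * millsRatio y)
      (1 * millsRatio y + y * (1 + y * millsRatio y)) y :=
    fun y => (hasDerivAt_id y).mul (hasDerivAt_millsRatio y)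
  refine monotone_of_deriv_nonneg (fun y => (hd y).differentiableAt) fun y => ?_
  rw [(hd y).deriv]
  have h := neg_div_le_Phi y
  have hp := gaussDensity_pos y
  have h2 : -(y / (1 + y ^ 2)) ≤ millsRatio y := by
    rw [millsRatio, le_div_iff₀ hp]
    calc _ = -(y * gaussDensity y / (1 + y ^ 2)) := by ring
      _ ≤ _ := h
  have h3 : -y ≤ millsRatio y * (1 + y ^ 2) := by
    rw [← div_le_iff₀ (by positivity), neg_div]; exact h2
  nlinarith

/-- For `x < 0` this is the upper tail bound `Φ(x) ≤ φ(x) / |x|`: the function `Φ + φ / y` decreases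
from its limit `0` at `-∞`. -/
lemma neg_one_le_mul_millsRatio (x : ℝ) : -1 ≤ x * millsRatio x := by
  rcases le_or_gt 0 x with hx | hx
  · have := mul_nonneg hx (millsRatio_nonneg x)
    linarith
  have hd : ∀ y : ℝ, y ≠ 0 → HasDerivAt (fun y => Phi y + gaussDensity y / y)
      (-(gaussDensity y / y ^ 2)) y := by
    intro y hy
    have h := (hasDerivAt_Phi y).add ((hasDerivAt_gaussDensity y).div (hasDerivAt_id y) hy)
    convert! h using 1
    simp
    field_simp
    ring
  have hanti : AntitoneOn (fun y => Phi y + gaussDensity y / y) (Iio 0) := by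
    refine antitoneOn_of_deriv_nonpos (convex_Iio 0)
      (fun y hy => (hd y (ne_of_lt hy)).continuousAt.continuousWithinAt)
      (fun y hy => ?_) (fun y hy => ?_) <;> rw [interior_Iio] at hy
    · exact (hd y (ne_of_lt hy)).differentiableAt.differentiableWithinAt
    · rw [(hd y (ne_of_lt hy)).deriv]
      have := gaussDensity_pos y
      have : 0 ≤ gaussDensity y / y ^ 2 := by positivity
      linarith
  have hlim : Tendsto (fun y => Phi y + gaussDensity y / y) atBot (𝓝 0) := by
    have := tendsto_Phi_atBot.add (tendsto_gaussDensity_atBot.mul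
      (tendsto_inv_atBot_zero (𝕜 := ℝ)))
    simpa [div_eq_mul_inv] using this
  have h1 : Phi x + gaussDensity x / x ≤ 0 := by
    refine ge_of_tendsto hlim ?_
    filter_upwards [eventually_le_atBot x] with y hy
    exact hanti (show y < 0 from lt_of_le_of_lt hy hx) hx hy
  have hp := gaussDensity_pos x
  have h2 : x * Phi x + gaussDensity x ≥ 0 := by
    have : x * (Phi x + gaussDensity x / x) = x * Phi x + gaussDensity x := by
      field_simp [hx.ne]
    nlinarith [mul_nonneg_of_nonpos_of_nonpos hx.le h1]
  rw [millsRatio, ← mul_div_assoc, le_div_iff₀ hp]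
  linarith

lemma millsRatio_sub_bounds {b a : ℝ} (hab : b ≤ a) :
    (1 + b * millsRatio b) * (a - b) ≤ millsRatio a - millsRatio b ∧
      millsRatio a - millsRatio b ≤ (1 + a * millsRatio a) * (a - b) := by
  rcases hab.eq_or_lt with rfl | hlt
  · simp
  obtain ⟨c, hc, h⟩ := exists_hasDerivAt_eq_slope millsRatio (fun x => 1 + x * millsRatio x) hlt
    (fun x _ => (hasDerivAt_millsRatio x).continuousAt.continuousWithinAt)
    (fun x _ => hasDerivAt_millsRatio x)
  have hpos : 0 < a - b := sub_pos.2 hlt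
  rw [eq_div_iff hpos.ne'] at h
  have h1 := monotone_mul_millsRatio hc.1.le
  have h2 := monotone_mul_millsRatio hc.2.le
  simp only at h1 h2
  constructor <;> rw [← h] <;> gcongr

/-- The bounded solution of the Stein equation `f'(w) - w f(w) = 1{w ≤ z} - Φ(z)`. -/
noncomputable def steinSol (z w : ℝ) : ℝ :=
  if w ≤ z then millsRatio w * Phi (-z) else millsRatio (-w) * Phi z

lemma steinSol_of_le {z w : ℝ} (h : w ≤ z) : steinSol z w = millsRatio w * Phi (-z) := if_pos h

lemma steinSol_of_ge {z w : ℝ} (h : z ≤ w) : steinSol z w = millsRatio (-w) * Phi z := by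
  rcases h.eq_or_lt with rfl | h
  · rw [steinSol_of_le le_rfl, millsRatio, millsRatio, gaussDensity_neg]
    ring
  · exact if_neg (not_le.2 h)

lemma measurable_millsRatio : Measurable millsRatio :=
  (continuous_iff_continuousAt.2 fun x => (hasDerivAt_millsRatio x).continuousAt).measurable

lemma measurable_steinSol (z : ℝ) : Measurable (steinSol z) := by
  refine Measurable.ite measurableSet_Iic ?_ ?_
  · exact measurable_millsRatio.mul_const _
  · exact (measurable_millsRatio.comp measurable_neg).mul_const _

/-- On each side of `z` the function is a nonnegative multiple of `x M(x)` or of its reflection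
`-(-w) M(-w)`, and the two branches agree at `z`. -/
lemma monotone_mul_steinSol (z : ℝ) : Monotone fun w => w * steinSol z w := by
  refine MonotoneOn.Iic_union_Ici (a := z) ?_ ?_
  · intro a ha b hb hab
    simp only [steinSol_of_le ha, steinSol_of_le hb, ← mul_assoc]
    exact mul_le_mul_of_nonneg_right (monotone_mul_millsRatio hab) (Phi_nonneg _)
  · intro a ha b hb hab
    have := monotone_mul_millsRatio (neg_le_neg hab)
    simp only [steinSol_of_ge ha, steinSol_of_ge hb, ← mul_assoc]
    refine mul_le_mul_of_nonneg_right ?_ (Phi_nonneg _)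
    simp only at this
    linarith

/-- By monotonicity, a lower bound to the left of `z` and an upper bound to the right suffice; each
is `neg_one_le_mul_millsRatio`. -/
lemma abs_mul_steinSol_le (z w : ℝ) : |w * steinSol z w| ≤ 1 := by
  have hlow : ∀ w, w ≤ z → -1 ≤ w * steinSol z w := by
    intro w h
    rw [steinSol_of_le h, ← mul_assoc]
    have h1 := neg_one_le_mul_millsRatio w
    have h2 := Phi_nonneg (-z)
    have h3 := Phi_le_one (-z)
    nlinarith
  have hup : ∀ w, z ≤ w → w * steinSol z w ≤ 1 := by
    intro w h
    rw [steinSol_of_ge h, ← mul_assoc]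
    have h1 := neg_one_le_mul_millsRatio (-w)
    have h2 := Phi_nonneg z
    have h3 := Phi_le_one z
    nlinarith
  have hmono := monotone_mul_steinSol z
  rw [abs_le]
  rcases le_total w z with h | h
  · exact ⟨hlow w h, (hmono h).trans (hup z le_rfl)⟩
  · exact ⟨(hlow z le_rfl).trans (hmono h), hup w h⟩

/-- The slope is `w f(w) + 1{w ≤ z} - Φ(z)`, whose first term increases and whose second decreases.
Evaluating the two at opposite endpoints bounds it on the whole interval. -/
lemma steinSol_sub_bounds (z : ℝ) {b a : ℝ} (hab : b ≤ a) :
    (b * steinSol z b + (if a ≤ z then 1 else 0) - Phi z) * (a - b) ≤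
        steinSol z a - steinSol z b ∧
      steinSol z a - steinSol z b ≤
        (a * steinSol z a + (if b ≤ z then 1 else 0) - Phi z) * (a - b) := by
  have hPhi := Phi_neg z
  have left : ∀ b a, b ≤ a → a ≤ z →
      (b * steinSol z b + 1 - Phi z) * (a - b) ≤ steinSol z a - steinSol z b ∧
      steinSol z a - steinSol z b ≤ (a * steinSol z a + 1 - Phi z) * (a - b) := by
    intro b a hab haz
    obtain ⟨h1, h2⟩ := millsRatio_sub_bounds hab
    rw [steinSol_of_le haz, steinSol_of_le (hab.trans haz)]
    have h3 := mul_le_mul_of_nonneg_right h1 (Phi_nonneg (-z))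
    have h4 := mul_le_mul_of_nonneg_right h2 (Phi_nonneg (-z))
    rw [show Phi z = 1 - Phi (-z) by linarith]
    constructor <;> linarith
  have right : ∀ b a, b ≤ a → z ≤ b →
      (b * steinSol z b - Phi z) * (a - b) ≤ steinSol z a - steinSol z b ∧
      steinSol z a - steinSol z b ≤ (a * steinSol z a - Phi z) * (a - b) := by
    intro b a hab hbz
    obtain ⟨h1, h2⟩ := millsRatio_sub_bounds (neg_le_neg hab)
    rw [steinSol_of_ge hbz, steinSol_of_ge (hbz.trans hab)]
    have h3 := mul_le_mul_of_nonneg_right h1 (Phi_nonneg z)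
    have h4 := mul_le_mul_of_nonneg_right h2 (Phi_nonneg z)
    constructor <;> linarith
  rcases le_or_gt a z with haz | haz
  · rw [if_pos haz, if_pos (hab.trans haz)]
    exact left b a hab haz
  rw [if_neg (not_le.2 haz)]
  rcases le_or_gt b z with hbz | hbz
  · rw [if_pos hbz]
    -- The interval straddles the kink: the bounds on `[b, z]` and `[z, a]` are added, and
    -- monotonicity of `w f(w)` moves its value at `z` to an endpoint.
    obtain ⟨h1, h2⟩ := left b z hbz le_rfl
    obtain ⟨h3, h4⟩ := right z a haz.le le_rfl
    have h5 := monotone_mul_steinSol z hbz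
    have h6 := monotone_mul_steinSol z haz.le
    simp only at h5 h6
    constructor <;> nlinarith
  · rw [if_neg (not_le.2 hbz)]
    simpa using right b a hab hbz.le

/-- The derivative of the Stein solution, as given by the Stein equation. -/
noncomputable def steinDeriv (z w : ℝ) : ℝ :=
  w * steinSol z w + (if w ≤ z then 1 else 0) - Phi z

/-- A monotone function controlling the increments of `steinDeriv`. -/
noncomputable def steinMono (z w : ℝ) : ℝ := w * steinSol z w - (if w ≤ z then 1 else 0)

lemma measurable_indicator_le (z : ℝ) : Measurable fun w : ℝ => if w ≤ z then (1 : ℝ) else 0 :=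
  Measurable.ite measurableSet_Iic measurable_const measurable_const

lemma measurable_steinDeriv (z : ℝ) : Measurable (steinDeriv z) :=
  ((measurable_id.mul (measurable_steinSol z)).add (measurable_indicator_le z)).sub_const _

lemma measurable_steinMono (z : ℝ) : Measurable (steinMono z) :=
  (measurable_id.mul (measurable_steinSol z)).sub (measurable_indicator_le z)

lemma abs_steinDeriv_le (z w : ℝ) : |steinDeriv z w| ≤ 2 := by
  have h1 := abs_le.1 (abs_mul_steinSol_le z w)
  have h2 := Phi_nonneg z
  have h3 := Phi_le_one z
  unfold steinDeriv
  rw [abs_le]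
  split_ifs <;> constructor <;> linarith

lemma abs_steinMono_le (z w : ℝ) : |steinMono z w| ≤ 2 := by
  have h1 := abs_le.1 (abs_mul_steinSol_le z w)
  unfold steinMono
  rw [abs_le]
  split_ifs <;> constructor <;> linarith

/-- Replaces a second-order Taylor bound, which fails at the kink. The error on either side is at
most `|a - b|` times the variation of `w f(w)` or of the indicator; these move in opposite
directions, so the increment of `steinMono` has the size of the sum of both. -/
lemma abs_steinSol_sub_le (z a b : ℝ) :
    |steinSol z a - steinSol z b - steinDeriv z a * (a - b)| ≤
      (a - b) * (steinMono z a - steinMono z b) := by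
  unfold steinDeriv steinMono
  rw [abs_le]
  rcases le_total b a with hab | hab
  · obtain ⟨h1, h2⟩ := steinSol_sub_bounds z hab
    have h3 := monotone_mul_steinSol z hab
    simp only at h3
    have h4 : (if a ≤ z then (1 : ℝ) else 0) ≤ if b ≤ z then 1 else 0 := by
      split_ifs <;> first | (exfalso; linarith) | norm_num
    constructor <;> nlinarith
  · obtain ⟨h1, h2⟩ := steinSol_sub_bounds z hab
    have h3 := monotone_mul_steinSol z hab
    simp only at h3
    have h4 : (if b ≤ z then (1 : ℝ) else 0) ≤ if a ≤ z then 1 else 0 := by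
      split_ifs <;> first | (exfalso; linarith) | norm_num
    constructor <;> nlinarith

/-- A crude linear growth bound, used only for square integrability of `f(F)`. -/
lemma abs_steinSol_le (z w : ℝ) : |steinSol z w| ≤ |steinSol z 0| + 6 * |w| := by
  have h1 := abs_steinSol_sub_le z w 0
  have h2 := abs_steinDeriv_le z w
  have h3 : (w - 0) * (steinMono z w - steinMono z 0) ≤ |w| * 4 := by
    refine (le_abs_self _).trans ?_
    rw [abs_mul, sub_zero]
    gcongr
    refine (abs_sub _ _).trans ?_
    linarith [abs_steinMono_le z w, abs_steinMono_le z 0]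
  have h4 : |steinDeriv z w * (w - 0)| ≤ 2 * |w| := by
    rw [abs_mul, sub_zero]; gcongr
  calc |steinSol z w| = |steinSol z 0 + steinDeriv z w * (w - 0) +
        (steinSol z w - steinSol z 0 - steinDeriv z w * (w - 0))| := by ring_nf
    _ ≤ |steinSol z 0| + |steinDeriv z w * (w - 0)| +
        |steinSol z w - steinSol z 0 - steinDeriv z w * (w - 0)| := abs_add_three _ _ _
    _ ≤ _ := by linarith

end GaussianStein

/-! ### Resampling on product spaces: integration by parts and Efron–Stein -/

section ProductSpace

variable {ι E : Type*} [DecidableEq ι]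

/-- Takes the first copy of the coordinates in `A` and the second copy of the others. -/
def sel (A : Finset ι) (V : ι → E × E) : ι → E := fun j => if j ∈ A then (V j).1 else (V j).2

/-- Exchanges the two copies of the coordinate `i`. -/
def swapAt (i : ι) (V : ι → E × E) : ι → E × E := fun j => if j = i then (V j).swap else V j

lemma sel_swapAt (A : Finset ι) (i : ι) (V : ι → E × E) :
    sel A (swapAt i V) = sel (symmDiff A {i}) V := by
  funext j
  by_cases hj : j = i <;> by_cases hA : j ∈ A <;>
    simp [sel, swapAt, Finset.mem_symmDiff, hj, hA]

variable [Fintype ι]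

/-- The increment of `F` when the coordinate `i` is resampled. -/
def resampleDiff (F : (ι → E) → ℝ) (i : ι) (V : ι → E × E) : ℝ :=
  F (sel Finset.univ V) - F (sel {i}ᶜ V)

variable (ι) in
/-- The first `r` indices in a fixed enumeration. -/
noncomputable def initSeg (r : ℕ) : Finset ι :=
  Finset.univ.filter fun j => (Fintype.equivFin ι j : ℕ) < r

/-- The indices that precede `i` in a fixed enumeration. -/
noncomputable def preceding (i : ι) : Finset ι := initSeg ι (Fintype.equivFin ι i)

lemma notMem_preceding (i : ι) : i ∉ preceding i := by simp [preceding, initSeg]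

/-- The increment in the coordinate `i` along the path that resamples the coordinates one by one. -/
noncomputable def pathDiff (F : (ι → E) → ℝ) (i : ι) (V : ι → E × E) : ℝ :=
  F (sel (insert i (preceding i)) V) - F (sel (preceding i) V)

lemma insert_preceding (i : ι) :
    insert i (preceding i) = initSeg ι ((Fintype.equivFin ι i : ℕ) + 1) := by
  ext j
  simp only [preceding, initSeg, Finset.mem_insert, Finset.mem_filter, Finset.mem_univ, true_and]
  rw [Nat.lt_succ_iff_lt_or_eq, ← Fin.ext_iff, EmbeddingLike.apply_eq_iff_eq]
  tauto

lemma sum_pathDiff (F : (ι → E) → ℝ) (V : ι → E × E) :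
    ∑ i, pathDiff F i V = F (sel Finset.univ V) - F (sel ∅ V) := by
  let G : Fin (Fintype.card ι) → ℝ := fun r =>
    F (sel (initSeg ι ((r : ℕ) + 1)) V) - F (sel (initSeg ι r) V)
  have h1 : ∀ i, pathDiff F i V = G (Fintype.equivFin ι i) := by
    intro i
    simp only [pathDiff, insert_preceding]
    rfl
  rw [Finset.sum_congr rfl fun i _ => h1 i, Equiv.sum_comp (Fintype.equivFin ι) G]
  simp only [G]
  rw [Fin.sum_univ_eq_sum_range (fun r => F (sel (initSeg ι (r + 1)) V) - F (sel (initSeg ι r) V)),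
    Finset.sum_range_sub fun r => F (sel (initSeg ι r) V)]
  congr 3 <;> ext j <;> simp [initSeg]

lemma pathDiff_swapAt (F : (ι → E) → ℝ) (i : ι) (V : ι → E × E) :
    pathDiff F i (swapAt i V) = -pathDiff F i V := by
  have hi := notMem_preceding i
  have h1 : symmDiff (insert i (preceding i)) {i} = preceding i := by
    ext j; by_cases hj : j = i <;> simp [Finset.mem_symmDiff, hj, hi]
  have h2 : symmDiff (preceding i) {i} = insert i (preceding i) := by
    ext j; by_cases hj : j = i <;> simp [Finset.mem_symmDiff, hj, hi]
  simp only [pathDiff, sel_swapAt, h1, h2]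
  ring

lemma sel_univ_swapAt (i : ι) (V : ι → E × E) :
    sel Finset.univ (swapAt i V) = sel {i}ᶜ V := by
  rw [sel_swapAt]; congr 1
  ext j; by_cases hj : j = i <;> simp [Finset.mem_symmDiff, hj]

lemma sel_compl_swapAt (i : ι) (V : ι → E × E) :
    sel {i}ᶜ (swapAt i V) = sel Finset.univ V := by
  rw [sel_swapAt]; congr 1
  ext j; by_cases hj : j = i <;> simp [hj]

lemma resampleDiff_swapAt (F : (ι → E) → ℝ) (i : ι) (V : ι → E × E) :
    resampleDiff F i (swapAt i V) = -resampleDiff F i V := by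
  simp only [resampleDiff, sel_univ_swapAt, sel_compl_swapAt]
  ring

/-- Exchanges the two copies of the coordinates that come after `i`. -/
noncomputable def swapAfter (i : ι) (V : ι → E × E) : ι → E × E :=
  fun j => if j ∈ insert i (preceding i) then V j else (V j).swap

/-- The path increment is a resampling increment for a relabelled pair of copies. Since the
relabelling preserves the law, both increments have the same distribution. -/
lemma pathDiff_eq_resampleDiff (F : (ι → E) → ℝ) (i : ι) (V : ι → E × E) :
    pathDiff F i V = resampleDiff F i (swapAfter i V) := by
  have hi := notMem_preceding i
  unfold pathDiff resampleDiff
  congr 2 <;> funext j <;> by_cases hj : j = i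
  · simp [sel, swapAfter, hj]
  · by_cases hA : j ∈ preceding i <;> simp [sel, swapAfter, hj, hA]
  · simp [sel, swapAfter, hj, hi]
  · by_cases hA : j ∈ preceding i <;> simp [sel, swapAfter, hj, hA]

variable [MeasurableSpace E] (ν : Measure E) [IsProbabilityMeasure ν]

lemma measurePreserving_sel (A : Finset ι) :
    MeasurePreserving (sel A) (Measure.pi fun _ : ι => ν.prod ν) (Measure.pi fun _ : ι => ν) := by
  refine measurePreserving_pi (fun _ : ι => ν.prod ν) (fun _ : ι => ν)
    (f := fun j p => if j ∈ A then p.1 else p.2) fun j => ?_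
  by_cases hj : j ∈ A
  · simpa [hj] using measurePreserving_fst
  · simpa [hj] using measurePreserving_snd

lemma measurePreserving_swapAt (i : ι) :
    MeasurePreserving (swapAt i) (Measure.pi fun _ : ι => ν.prod ν)
      (Measure.pi fun _ : ι => ν.prod ν) := by
  refine measurePreserving_pi (fun _ : ι => ν.prod ν) (fun _ : ι => ν.prod ν)
    (f := fun j p => if j = i then p.swap else p) fun j => ?_
  by_cases hj : j = i
  · simpa [hj] using Measure.measurePreserving_swap
  · simp only [hj]; exact MeasurePreserving.id _

lemma measurePreserving_swapAfter (i : ι) :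
    MeasurePreserving (swapAfter i) (Measure.pi fun _ : ι => ν.prod ν)
      (Measure.pi fun _ : ι => ν.prod ν) := by
  refine measurePreserving_pi (fun _ : ι => ν.prod ν) (fun _ : ι => ν.prod ν)
    (f := fun j p => if j ∈ insert i (preceding i) then p else p.swap) fun j => ?_
  by_cases hj : j ∈ insert i (preceding i)
  · simp only [hj]
    exact MeasurePreserving.id _
  · simp only [hj]
    exact Measure.measurePreserving_swap

lemma memLp_comp_sel {F : (ι → E) → ℝ} {p : ENNReal} (hF : MemLp F p (Measure.pi fun _ => ν))
    (A : Finset ι) : MemLp (fun V => F (sel A V)) p (Measure.pi fun _ => ν.prod ν) :=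
  hF.comp_measurePreserving (measurePreserving_sel ν A)

lemma memLp_resampleDiff {F : (ι → E) → ℝ} {p : ENNReal} (hF : MemLp F p (Measure.pi fun _ => ν))
    (i : ι) : MemLp (resampleDiff F i) p (Measure.pi fun _ => ν.prod ν) :=
  (memLp_comp_sel ν hF _).sub (memLp_comp_sel ν hF _)

lemma memLp_pathDiff {F : (ι → E) → ℝ} {p : ENNReal} (hF : MemLp F p (Measure.pi fun _ => ν))
    (i : ι) : MemLp (pathDiff F i) p (Measure.pi fun _ => ν.prod ν) :=
  (memLp_comp_sel ν hF _).sub (memLp_comp_sel ν hF _)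

lemma eLpNorm_pathDiff {F : (ι → E) → ℝ} {p : ENNReal} (hF : MemLp F p (Measure.pi fun _ => ν))
    (i : ι) : eLpNorm (pathDiff F i) p (Measure.pi fun _ => ν.prod ν) =
      eLpNorm (resampleDiff F i) p (Measure.pi fun _ => ν.prod ν) := by
  have : pathDiff F i = resampleDiff F i ∘ swapAfter i :=
    funext fun V => pathDiff_eq_resampleDiff F i V
  rw [this]
  exact eLpNorm_comp_measurePreserving (memLp_resampleDiff ν hF i).1
    (measurePreserving_swapAfter ν i)

lemma integral_comp_measurePreserving {α β : Type*} [MeasurableSpace α] [MeasurableSpace β]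
    {μ : Measure α} {μ' : Measure β} {T : α → β} (hT : MeasurePreserving T μ μ') {G : β → ℝ}
    (hG : AEStronglyMeasurable G μ') : ∫ x, G (T x) ∂μ = ∫ y, G y ∂μ' := by
  rw [← hT.map_eq] at hG ⊢
  exact (integral_map hT.measurable.aemeasurable hG).symm

/-- The two selections use disjoint copies of the sample, hence are independent; for centred `F`
this kills the far end of the telescoping sum. -/
lemma integral_sel_empty_mul_sel_univ (F φ : (ι → E) → ℝ)
    (hF : AEStronglyMeasurable F (Measure.pi fun _ => ν))
    (hφ : AEStronglyMeasurable φ (Measure.pi fun _ => ν)) :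
    ∫ V, F (sel ∅ V) * φ (sel Finset.univ V) ∂(Measure.pi fun _ => ν.prod ν) =
      (∫ x, F x ∂(Measure.pi fun _ => ν)) * ∫ x, φ x ∂(Measure.pi fun _ => ν) := by
  have hT := measurePreserving_arrowProdEquivProdArrow E E ι (fun _ => ν) (fun _ => ν)
  have h := integral_comp_measurePreserving hT (G := fun p => φ p.1 * F p.2)
    ((hφ.comp_fst).mul (hF.comp_snd))
  rw [integral_prod_mul] at h
  rw [mul_comm, ← h]
  refine integral_congr_ae (.of_forall fun V => ?_)
  simp only [MeasurableEquiv.arrowProdEquivProdArrow, Equiv.arrowProdEquivProdArrow]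
  rw [mul_comm]
  congr 2 <;> funext j <;> simp [sel]

/-- Integration by parts: `E[F φ] = ½ ∑ᵢ E[Dᵢ F · Δᵢ φ]` for centred `F`. -/
theorem integral_mul_eq_sum_pathDiff {F φ : (ι → E) → ℝ}
    (hF : MemLp F 2 (Measure.pi fun _ => ν)) (hφ : MemLp φ 2 (Measure.pi fun _ => ν))
    (hF0 : ∫ x, F x ∂(Measure.pi fun _ => ν) = 0) :
    ∫ x, F x * φ x ∂(Measure.pi fun _ => ν) =
      1 / 2 * ∑ i, ∫ V, pathDiff F i V * resampleDiff φ i V ∂(Measure.pi fun _ => ν.prod ν) := by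
  set Q := Measure.pi fun _ : ι => ν.prod ν
  have hφs := fun A => memLp_comp_sel ν hφ A
  have hFs := fun A => memLp_comp_sel ν hF A
  have hD := fun i => memLp_pathDiff ν hF i
  have hI : ∀ i A, Integrable (fun V => pathDiff F i V * φ (sel A V)) Q :=
    fun i A => (hD i).integrable_mul (hφs A)
  have h1 : ∫ x, F x * φ x ∂(Measure.pi fun _ => ν) =
      ∫ V, F (sel Finset.univ V) * φ (sel Finset.univ V) ∂Q :=
    (integral_comp_measurePreserving (measurePreserving_sel ν Finset.univ)
      (G := fun x => F x * φ x) (hF.1.mul hφ.1)).symm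
  have h2 : ∫ V, F (sel ∅ V) * φ (sel Finset.univ V) ∂Q = 0 := by
    rw [integral_sel_empty_mul_sel_univ ν F φ hF.1 hφ.1, hF0, zero_mul]
  have h3 : ∫ x, F x * φ x ∂(Measure.pi fun _ => ν) =
      ∑ i, ∫ V, pathDiff F i V * φ (sel Finset.univ V) ∂Q := by
    have hI' : ∀ A, Integrable (fun V => F (sel A V) * φ (sel Finset.univ V)) Q :=
      fun A => (hFs A).integrable_mul (hφs _)
    rw [← integral_finsetSum _ fun i _ => hI i _]
    rw [h1, ← sub_zero (∫ V, F (sel Finset.univ V) * φ (sel Finset.univ V) ∂Q), ← h2,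
      ← integral_sub (hI' _) (hI' _)]
    refine integral_congr_ae (.of_forall fun V => ?_)
    simp only
    rw [← Finset.sum_mul, sum_pathDiff]
    ring
  rw [h3, Finset.mul_sum]
  refine Finset.sum_congr rfl fun i _ => ?_
  -- Swapping the two copies of coordinate `i` flips the sign of `D_i` and moves `φ` to the
  -- resampled point. Averaging the two forms produces `Δ_i φ` and the factor `½`.
  have h4 : ∫ V, pathDiff F i V * φ (sel Finset.univ V) ∂Q =
      ∫ V, -(pathDiff F i V * φ (sel {i}ᶜ V)) ∂Q := by
    rw [← integral_comp_measurePreserving (measurePreserving_swapAt ν i)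
      (G := fun V => pathDiff F i V * φ (sel Finset.univ V)) ((hD i).1.mul (hφs _).1)]
    refine integral_congr_ae (.of_forall fun V => ?_)
    simp only [pathDiff_swapAt, sel_univ_swapAt]
    ring
  have h5 : ∫ V, pathDiff F i V * resampleDiff φ i V ∂Q =
      ∫ V, pathDiff F i V * φ (sel Finset.univ V) ∂Q -
        ∫ V, pathDiff F i V * φ (sel {i}ᶜ V) ∂Q := by
    rw [← integral_sub (hI i _) (hI i _)]
    refine integral_congr_ae (.of_forall fun V => ?_)
    simp only [resampleDiff]
    ring
  rw [integral_neg] at h4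
  rw [h5]
  linarith

lemma integral_sq_pathDiff {F : (ι → E) → ℝ} (hF : MemLp F 2 (Measure.pi fun _ => ν)) (i : ι) :
    ∫ V, pathDiff F i V ^ 2 ∂(Measure.pi fun _ => ν.prod ν) =
      ∫ V, resampleDiff F i V ^ 2 ∂(Measure.pi fun _ => ν.prod ν) := by
  simp_rw [pathDiff_eq_resampleDiff]
  exact integral_comp_measurePreserving (measurePreserving_swapAfter ν i)
    (G := fun V => resampleDiff F i V ^ 2) ((memLp_resampleDiff ν hF i).1.pow 2)

/-- The Efron–Stein inequality. -/
theorem variance_le_sum_resampleDiff {F : (ι → E) → ℝ} (hF : MemLp F 2 (Measure.pi fun _ => ν)) :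
    Var[F; Measure.pi fun _ => ν] ≤
      1 / 2 * ∑ i, ∫ V, resampleDiff F i V ^ 2 ∂(Measure.pi fun _ => ν.prod ν) := by
  set c := ∫ x, F x ∂(Measure.pi fun _ => ν)
  have hc : MemLp (fun x => F x - c) 2 (Measure.pi fun _ : ι => ν) := hF.sub (memLp_const c)
  have hFi : Integrable F (Measure.pi fun _ : ι => ν) := hF.integrable one_le_two
  have hc0 : ∫ x, (F x - c) ∂(Measure.pi fun _ => ν) = 0 := by
    rw [integral_sub hFi (integrable_const _)]
    simp [c]
  have hres : ∀ i, resampleDiff (fun x => F x - c) i = resampleDiff F i := by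
    intro i; funext V; simp [resampleDiff]
  rw [variance_eq_integral hF.1.aemeasurable]
  have h := integral_mul_eq_sum_pathDiff ν hc hc hc0
  simp_rw [← sq] at h
  rw [h]
  refine mul_le_mul_of_nonneg_left (Finset.sum_le_sum fun i _ => ?_) (by norm_num)
  rw [hres]
  have h1 : ∀ V, pathDiff (fun x => F x - c) i V = pathDiff F i V := by
    intro V; simp [pathDiff]
  simp_rw [h1]
  have hD := memLp_pathDiff ν hF i
  have hR := memLp_resampleDiff ν hF i
  -- `D_i` and `Δ_i` have equal second moments, so the arithmetic–geometric mean inequality leaves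
  -- `E Δ_i²`.
  calc ∫ V, pathDiff F i V * resampleDiff F i V ∂(Measure.pi fun _ => ν.prod ν)
      ≤ ∫ V, (1 / 2 * pathDiff F i V ^ 2 + 1 / 2 * resampleDiff F i V ^ 2)
          ∂(Measure.pi fun _ => ν.prod ν) := by
        refine integral_mono (hD.integrable_mul hR)
          ((hD.integrable_sq.const_mul _).add (hR.integrable_sq.const_mul _)) fun V => ?_
        simp only
        nlinarith [sq_nonneg (pathDiff F i V - resampleDiff F i V)]
    _ = _ := by
        rw [integral_add (hD.integrable_sq.const_mul _) (hR.integrable_sq.const_mul _),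
          integral_const_mul, integral_const_mul, integral_sq_pathDiff ν hF]
        ring

end ProductSpace

/-! ### Variance of `∑ ψ(D_i) Δ_i` through second-order differences -/

section NormalApproximation

instance : ENNReal.HolderTriple 4 4 2 where
  inv_add_inv_eq_inv := by
    rw [← two_mul, show (4 : ENNReal) = 2 * 2 by norm_num,
      ENNReal.mul_inv (by simp) (by simp), ← mul_assoc,
      ENNReal.mul_inv_cancel (by simp) (by simp), one_mul]

lemma eLpNorm_mul_le_four {α : Type*} [MeasurableSpace α] {μ : Measure α} {f g : α → ℝ}
    (hf : AEStronglyMeasurable f μ) (hg : AEStronglyMeasurable g μ) :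
    eLpNorm (fun x => f x * g x) 2 μ ≤ eLpNorm f 4 μ * eLpNorm g 4 μ :=
by
  have h : (fun x => f x * g x) = f • g := rfl
  rw [h]
  exact eLpNorm_smul_le_mul_eLpNorm (p := 4) (q := 4) (r := 2) hg hf

lemma eLpNorm_fun_comp {α β : Type*} [MeasurableSpace α] [MeasurableSpace β] {μ : Measure α}
    {μ' : Measure β} {p : ENNReal} {g : β → ℝ} {T : α → β} (hg : AEStronglyMeasurable g μ')
    (hT : MeasurePreserving T μ μ') : eLpNorm (fun x => g (T x)) p μ = eLpNorm g p μ' := by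
  have h : (fun x => g (T x)) = g ∘ T := rfl
  rw [h]
  exact eLpNorm_comp_measurePreserving hg hT

lemma integral_sq_le_of_eLpNorm_le {α : Type*} [MeasurableSpace α] {μ : Measure α} {f : α → ℝ}
    (hf : MemLp f 2 μ) {c : NNReal} (h : eLpNorm f 2 μ ≤ c) : ∫ x, f x ^ 2 ∂μ ≤ (c : ℝ) ^ 2 := by
  rw [hf.eLpNorm_eq_integral_rpow_norm two_ne_zero (by simp)] at h
  have h1 : (∫ x, ‖f x‖ ^ (2 : ENNReal).toReal ∂μ) = ∫ x, f x ^ 2 ∂μ := by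
    refine integral_congr_ae (.of_forall fun x => ?_)
    simp
  rw [h1, ← ENNReal.ofReal_coe_nnreal] at h
  replace h := (ENNReal.ofReal_le_ofReal_iff c.2).1 h
  have h0 : 0 ≤ ∫ x, f x ^ 2 ∂μ := integral_nonneg fun x => sq_nonneg _
  have h2 : (∫ x, f x ^ 2 ∂μ) ^ ((2 : ENNReal).toReal)⁻¹ = √(∫ x, f x ^ 2 ∂μ) := by
    rw [Real.sqrt_eq_rpow]; norm_num
  rw [h2] at h
  exact (Real.sqrt_le_left c.2).1 h

lemma integral_abs_sub_mean_le {α : Type*} [MeasurableSpace α] {μ : Measure α}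
    [IsProbabilityMeasure μ] {f : α → ℝ} (hf : MemLp f 2 μ) :
    ∫ x, |f x - ∫ y, f y ∂μ| ∂μ ≤ √(Var[f; μ]) := by
  have hg : MemLp (fun x => |f x - ∫ y, f y ∂μ|) 2 μ := (hf.sub (memLp_const _)).abs
  have h1 := variance_nonneg (fun x => |f x - ∫ y, f y ∂μ|) μ
  rw [variance_eq_sub hg] at h1
  rw [variance_eq_integral hf.1.aemeasurable]
  refine Real.le_sqrt_of_sq_le ?_
  have h2 : ∫ x, ((fun x => |f x - ∫ y, f y ∂μ|) ^ 2) x ∂μ = ∫ x, (f x - ∫ y, f y ∂μ) ^ 2 ∂μ := by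
    refine integral_congr_ae (.of_forall fun x => ?_)
    simp
  rw [h2] at h1
  linarith

variable {ι E : Type*} [DecidableEq ι] [Fintype ι]

/-- `∑ᵢ ψ(Dᵢ) Δᵢ`. -/
noncomputable def pairSum (ψ : ℝ → ℝ) (F : (ι → E) → ℝ) (V : ι → E × E) : ℝ :=
  ∑ i, ψ (pathDiff F i V) * resampleDiff F i V

/-- The second-order difference of `F` in the coordinates `i` and `l`. -/
def mixDiff (F : (ι → E) → ℝ) (i l : ι) (V : ι → E × E) : ℝ :=
  F (sel Finset.univ V) - F (sel {i}ᶜ V) - F (sel {l}ᶜ V) + F (sel {i, l}ᶜ V)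

/-- The pairs whose second-order difference is the change of a first-order difference of `F` in the
coordinate `i` when another pair is resampled. -/
def pairUp (i : ι) (A : Finset ι) (U : ι → (E × E) × (E × E)) : ι → E × E :=
  fun j => if j = i then (U j).1 else
    if j ∈ A then Prod.map Prod.fst Prod.fst (U j) else Prod.map Prod.snd Prod.snd (U j)

/-- When whole pairs are resampled, a first-order difference in `i` reads only one entry of each
pair at `j ≠ i`: the first for `j ∈ A`, the second otherwise. Matching that entry of the old pair
with that of the new one gives the two copies needed for a second-order difference. Both `D_i` and
`Δ_i` are instances, with `A = preceding i` and `A = {i}ᶜ`. -/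
lemma sub_eq_mixDiff_pairUp (F : (ι → E) → ℝ) {i l : ι} (hil : i ≠ l) {A : Finset ι} (hi : i ∉ A)
    (U : ι → (E × E) × (E × E)) :
    (F (sel (insert i A) (sel Finset.univ U)) - F (sel A (sel Finset.univ U))) -
      (F (sel (insert i A) (sel {l}ᶜ U)) - F (sel A (sel {l}ᶜ U))) =
      mixDiff F i l (pairUp i A U) := by
  have h1 : sel (insert i A) (sel Finset.univ U) = sel Finset.univ (pairUp i A U) := by
    funext j
    by_cases hj : j = i <;> by_cases hA : j ∈ A <;> simp [sel, pairUp, hj, hA]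
  have h2 : sel A (sel Finset.univ U) = sel {i}ᶜ (pairUp i A U) := by
    funext j
    by_cases hj : j = i
    · simp [sel, pairUp, hj, hi]
    · by_cases hA : j ∈ A <;> simp [sel, pairUp, hj, hA]
  have h3 : sel (insert i A) (sel {l}ᶜ U) = sel {l}ᶜ (pairUp i A U) := by
    funext j
    by_cases hj : j = i
    · simp [sel, pairUp, hj, hil]
    · by_cases hl : j = l <;> by_cases hA : j ∈ A <;> simp_all [sel, pairUp]
  have h4 : sel A (sel {l}ᶜ U) = sel {i, l}ᶜ (pairUp i A U) := by
    funext j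
    by_cases hj : j = i
    · simp [sel, pairUp, hj, hil, hi]
    · by_cases hl : j = l <;> by_cases hA : j ∈ A <;> simp_all [sel, pairUp]
  rw [h1, h2, h3, h4, mixDiff]
  ring

variable [MeasurableSpace E] (ν : Measure E) [IsProbabilityMeasure ν]

lemma measurePreserving_pairUp (i : ι) (A : Finset ι) :
    MeasurePreserving (pairUp i A) (Measure.pi fun _ : ι => (ν.prod ν).prod (ν.prod ν))
      (Measure.pi fun _ : ι => ν.prod ν) := by
  refine measurePreserving_pi (fun _ : ι => (ν.prod ν).prod (ν.prod ν)) (fun _ : ι => ν.prod ν)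
    (f := fun j p => if j = i then p.1 else
      if j ∈ A then Prod.map Prod.fst Prod.fst p else Prod.map Prod.snd Prod.snd p) fun j => ?_
  by_cases hj : j = i
  · simp only [hj]; exact measurePreserving_fst
  · by_cases hA : j ∈ A
    · simp only [hj, hA]; exact measurePreserving_fst.prod measurePreserving_fst
    · simp only [hj, hA]; exact measurePreserving_snd.prod measurePreserving_snd

variable {ν} {F : (ι → E) → ℝ}

lemma memLp_mixDiff {p : ENNReal} (hF : MemLp F p (Measure.pi fun _ => ν)) (i l : ι) :
    MemLp (mixDiff F i l) p (Measure.pi fun _ => ν.prod ν) :=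
  (((memLp_comp_sel ν hF _).sub (memLp_comp_sel ν hF _)).sub (memLp_comp_sel ν hF _)).add
    (memLp_comp_sel ν hF _)

lemma eLpNorm_mixDiff_pairUp {p : ENNReal} (hF : MemLp F p (Measure.pi fun _ => ν)) (i l : ι)
    (A : Finset ι) : eLpNorm (fun U => mixDiff F i l (pairUp i A U)) p
      (Measure.pi fun _ => (ν.prod ν).prod (ν.prod ν)) =
      eLpNorm (mixDiff F i l) p (Measure.pi fun _ => ν.prod ν) :=
  eLpNorm_fun_comp (memLp_mixDiff hF i l).1 (measurePreserving_pairUp ν i A)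

lemma pathDiff_sub_eq_mixDiff {i l : ι} (hil : i ≠ l) (U : ι → (E × E) × (E × E)) :
    pathDiff F i (sel Finset.univ U) - pathDiff F i (sel {l}ᶜ U) =
      mixDiff F i l (pairUp i (preceding i) U) :=
  sub_eq_mixDiff_pairUp F hil (notMem_preceding i) U

lemma resampleDiff_sub_eq_mixDiff {i l : ι} (hil : i ≠ l) (U : ι → (E × E) × (E × E)) :
    resampleDiff F i (sel Finset.univ U) - resampleDiff F i (sel {l}ᶜ U) =
      mixDiff F i l (pairUp i {i}ᶜ U) := by
  have h : insert i ({i}ᶜ : Finset ι) = Finset.univ := by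
    ext j; by_cases hj : j = i <;> simp [hj]
  have := sub_eq_mixDiff_pairUp F hil (A := {i}ᶜ) (by simp) U
  rw [h] at this
  exact this

variable {ψ : ℝ → ℝ}

lemma memLp_comp_lipschitz {α : Type*} [MeasurableSpace α] {μ : Measure α} {p : ENNReal}
    {f : α → ℝ} (hf : MemLp f p μ) (hψ : LipschitzWith 1 ψ) (hψ0 : ψ 0 = 0) :
    MemLp (fun x => ψ (f x)) p μ :=
  hψ.comp_memLp hψ0 hf

lemma abs_apply_le_of_lipschitz (hψ : LipschitzWith 1 ψ) (hψ0 : ψ 0 = 0) (x : ℝ) : |ψ x| ≤ |x| := by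
  have := hψ.dist_le_mul x 0
  simpa [Real.dist_eq, hψ0] using this

lemma memLp_pair_term (hF : MemLp F 4 (Measure.pi fun _ => ν)) (hψ : LipschitzWith 1 ψ)
    (hψ0 : ψ 0 = 0) (i : ι) :
    MemLp (fun V => ψ (pathDiff F i V) * resampleDiff F i V) 2 (Measure.pi fun _ => ν.prod ν) :=
  MemLp.mul' (memLp_resampleDiff ν hF i) (memLp_comp_lipschitz (memLp_pathDiff ν hF i) hψ hψ0)

lemma memLp_pairSum (hF : MemLp F 4 (Measure.pi fun _ => ν)) (hψ : LipschitzWith 1 ψ)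
    (hψ0 : ψ 0 = 0) : MemLp (pairSum ψ F) 2 (Measure.pi fun _ => ν.prod ν) :=
  memLp_finsetSum _ fun i _ => memLp_pair_term hF hψ hψ0 i

lemma eLpNorm_pair_term_le (hF : MemLp F 4 (Measure.pi fun _ => ν)) (hψ : LipschitzWith 1 ψ)
    (hψ0 : ψ 0 = 0) (i : ι) :
    eLpNorm (fun V => ψ (pathDiff F i V) * resampleDiff F i V) 2 (Measure.pi fun _ => ν.prod ν) ≤
      eLpNorm (resampleDiff F i) 4 (Measure.pi fun _ => ν.prod ν) *
        eLpNorm (resampleDiff F i) 4 (Measure.pi fun _ => ν.prod ν) := by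
  refine (eLpNorm_mul_le_four (memLp_comp_lipschitz (memLp_pathDiff ν hF i) hψ hψ0).1
    (memLp_resampleDiff ν hF i).1).trans ?_
  gcongr
  rw [← eLpNorm_pathDiff ν hF i]
  exact eLpNorm_mono fun V => abs_apply_le_of_lipschitz hψ hψ0 _

/-- Product rule for differences, `ψ(D)Δ - ψ(D')Δ' = (ψ(D) - ψ(D'))Δ + ψ(D')(Δ - Δ')`, followed by
the Lipschitz property and Hölder with exponents `4, 4, 2`. -/
lemma eLpNorm_pair_term_sub_le (hF : MemLp F 4 (Measure.pi fun _ => ν)) (hψ : LipschitzWith 1 ψ)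
    (hψ0 : ψ 0 = 0) {i l : ι} (hil : i ≠ l) :
    eLpNorm (fun U => ψ (pathDiff F i (sel Finset.univ U)) * resampleDiff F i (sel Finset.univ U) -
      ψ (pathDiff F i (sel {l}ᶜ U)) * resampleDiff F i (sel {l}ᶜ U)) 2
      (Measure.pi fun _ => (ν.prod ν).prod (ν.prod ν)) ≤
      2 * (eLpNorm (resampleDiff F i) 4 (Measure.pi fun _ => ν.prod ν) *
        eLpNorm (mixDiff F i l) 4 (Measure.pi fun _ => ν.prod ν)) := by
  have hD := fun A => memLp_comp_sel (ν.prod ν) (memLp_pathDiff ν hF i) A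
  have hR := fun A => memLp_comp_sel (ν.prod ν) (memLp_resampleDiff ν hF i) A
  have hψD := fun A => memLp_comp_lipschitz (hD A) hψ hψ0
  have hRn : ∀ A, eLpNorm (fun U => resampleDiff F i (sel A U)) 4
      (Measure.pi fun _ => (ν.prod ν).prod (ν.prod ν)) =
      eLpNorm (resampleDiff F i) 4 (Measure.pi fun _ => ν.prod ν) := fun A =>
    eLpNorm_fun_comp (memLp_resampleDiff ν hF i).1 (measurePreserving_sel _ A)
  have hDn : ∀ A, eLpNorm (fun U => pathDiff F i (sel A U)) 4
      (Measure.pi fun _ => (ν.prod ν).prod (ν.prod ν)) =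
      eLpNorm (resampleDiff F i) 4 (Measure.pi fun _ => ν.prod ν) := fun A => by
    rw [← eLpNorm_pathDiff ν hF i]
    exact eLpNorm_fun_comp (memLp_pathDiff ν hF i).1 (measurePreserving_sel _ A)
  have heq : (fun U => ψ (pathDiff F i (sel Finset.univ U)) *
      resampleDiff F i (sel Finset.univ U) -
      ψ (pathDiff F i (sel {l}ᶜ U)) * resampleDiff F i (sel {l}ᶜ U)) =
      (fun U => (ψ (pathDiff F i (sel Finset.univ U)) - ψ (pathDiff F i (sel {l}ᶜ U))) *
        resampleDiff F i (sel Finset.univ U)) +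
      fun U => ψ (pathDiff F i (sel {l}ᶜ U)) *
        (resampleDiff F i (sel Finset.univ U) - resampleDiff F i (sel {l}ᶜ U)) := by
    funext U; simp only [Pi.add_apply]; ring
  rw [heq, two_mul]
  refine (eLpNorm_add_le (((hψD _).1.sub (hψD _).1).mul (hR _).1)
    ((hψD _).1.mul ((hR _).1.sub (hR _).1)) one_le_two).trans (add_le_add ?_ ?_)
  · refine (eLpNorm_mul_le_four ((hψD _).1.sub (hψD _).1) (hR _).1).trans ?_
    rw [hRn, mul_comm]
    gcongr
    rw [← eLpNorm_mixDiff_pairUp hF i l (preceding i)]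
    refine eLpNorm_mono fun U => ?_
    rw [← pathDiff_sub_eq_mixDiff hil]
    simpa [Real.dist_eq] using hψ.dist_le_mul (pathDiff F i (sel Finset.univ U))
      (pathDiff F i (sel {l}ᶜ U))
  · refine (eLpNorm_mul_le_four (g := fun U =>
      resampleDiff F i (sel Finset.univ U) - resampleDiff F i (sel {l}ᶜ U)) (hψD _).1
      ((hR _).1.sub (hR _).1)).trans ?_
    simp_rw [resampleDiff_sub_eq_mixDiff hil]
    rw [eLpNorm_mixDiff_pairUp hF]
    gcongr
    rw [← hDn {l}ᶜ]
    exact eLpNorm_mono fun U => abs_apply_le_of_lipschitz hψ hψ0 _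

/-- Bounds on the first- and second-order differences of `F` in `L⁴` control the variance of
`∑ᵢ ψ(Dᵢ) Δᵢ`. -/
lemma variance_pairSum_le (hF : MemLp F 4 (Measure.pi fun _ => ν)) (hψ : LipschitzWith 1 ψ)
    (hψ0 : ψ 0 = 0) {a β : NNReal} {b : ι → ι → NNReal}
    (ha : ∀ i, eLpNorm (resampleDiff F i) 4 (Measure.pi fun _ => ν.prod ν) ≤ a)
    (hb : ∀ i l, i ≠ l → eLpNorm (mixDiff F i l) 4 (Measure.pi fun _ => ν.prod ν) ≤ b i l)
    (hβ : ∀ l, ∑ i ∈ Finset.univ.erase l, b i l ≤ β) :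
    Var[pairSum ψ F; Measure.pi fun _ => ν.prod ν] ≤
      2 * Fintype.card ι * ((a : ℝ) * (a + β)) ^ 2 := by
  have hS := memLp_pairSum (ν := ν) hF hψ hψ0
  have hT := fun i => memLp_pair_term (ν := ν) hF hψ hψ0 i
  have hl : ∀ l, ∫ U, resampleDiff (pairSum ψ F) l U ^ 2
      ∂(Measure.pi fun _ => (ν.prod ν).prod (ν.prod ν)) ≤ ((2 * (a * (a + β)) : NNReal) : ℝ) ^ 2 := by
    intro l
    refine integral_sq_le_of_eLpNorm_le (memLp_resampleDiff (ν.prod ν) hS l) ?_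
    have heq : resampleDiff (pairSum ψ F) l = ∑ i, fun U =>
        ψ (pathDiff F i (sel Finset.univ U)) * resampleDiff F i (sel Finset.univ U) -
          ψ (pathDiff F i (sel {l}ᶜ U)) * resampleDiff F i (sel {l}ᶜ U) := by
      funext U
      simp only [resampleDiff, pairSum, Finset.sum_apply]
      rw [← Finset.sum_sub_distrib]
    have hmeas := fun i A => (memLp_comp_sel (ν.prod ν) (hT i) A).1
    rw [heq]
    refine (eLpNorm_sum_le (fun i _ => (hmeas i _).sub (hmeas i _)) one_le_two).trans ?_
    -- The diagonal term `i = l` is bounded by the triangle inequality, costing `2a²`; the others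
    -- change only through second-order differences, costing `2aβ` in total.
    rw [← Finset.add_sum_erase _ _ (Finset.mem_univ l)]
    have h1 : eLpNorm (fun U =>
        ψ (pathDiff F l (sel Finset.univ U)) * resampleDiff F l (sel Finset.univ U) -
          ψ (pathDiff F l (sel {l}ᶜ U)) * resampleDiff F l (sel {l}ᶜ U)) 2
        (Measure.pi fun _ => (ν.prod ν).prod (ν.prod ν)) ≤ ((2 * (a * a) : NNReal) : ENNReal) := by
      have hn : ∀ A, eLpNorm (fun U => ψ (pathDiff F l (sel A U)) * resampleDiff F l (sel A U)) 2
          (Measure.pi fun _ => (ν.prod ν).prod (ν.prod ν)) ≤ (a : ENNReal) * a := by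
        intro A
        refine (eLpNorm_fun_comp (hT l).1
          (measurePreserving_sel (ν.prod ν) A)).le.trans ?_
        exact (eLpNorm_pair_term_le hF hψ hψ0 l).trans (mul_le_mul' (ha l) (ha l))
      refine (eLpNorm_sub_le (hmeas l _) (hmeas l _) one_le_two).trans ?_
      refine (add_le_add (hn _) (hn _)).trans (le_of_eq ?_)
      push_cast; ring
    have h2 : ∑ i ∈ Finset.univ.erase l, eLpNorm (fun U =>
        ψ (pathDiff F i (sel Finset.univ U)) * resampleDiff F i (sel Finset.univ U) -
          ψ (pathDiff F i (sel {l}ᶜ U)) * resampleDiff F i (sel {l}ᶜ U)) 2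
        (Measure.pi fun _ => (ν.prod ν).prod (ν.prod ν)) ≤ ((2 * (a * β) : NNReal) : ENNReal) := by
      calc _ ≤ ∑ i ∈ Finset.univ.erase l, ((2 * (a * b i l) : NNReal) : ENNReal) := by
            refine Finset.sum_le_sum fun i hi => ?_
            have hil := Finset.ne_of_mem_erase hi
            refine (eLpNorm_pair_term_sub_le hF hψ hψ0 hil).trans ?_
            push_cast
            gcongr
            · exact ha i
            · exact hb i l hil
        _ ≤ _ := by
            rw [← ENNReal.ofNNReal_finsetSum, ENNReal.coe_le_coe, ← Finset.mul_sum, ← Finset.mul_sum]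
            gcongr
            exact hβ l
    refine (add_le_add h1 h2).trans (le_of_eq ?_)
    push_cast; ring
  refine (variance_le_sum_resampleDiff (ν.prod ν) hS).trans ?_
  calc _ ≤ 1 / 2 * ∑ _l : ι, ((2 * (a * (a + β)) : NNReal) : ℝ) ^ 2 :=
        mul_le_mul_of_nonneg_left (Finset.sum_le_sum fun l _ => hl l) (by norm_num)
    _ = _ := by
        rw [Finset.sum_const, Finset.card_univ, nsmul_eq_mul]
        push_cast; ring

end NormalApproximation

/-! ### Stein's method for functions of independent variables -/

section SteinMethod

variable {ι E : Type*} [DecidableEq ι] [Fintype ι] [MeasurableSpace E] {ν : Measure E}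
  [IsProbabilityMeasure ν] {F : (ι → E) → ℝ}

/-- Integration by parts with `φ = F`: half the sum has mean `E F² = 1`. -/
lemma integral_pairSum_id (hF : MemLp F 4 (Measure.pi fun _ => ν))
    (hF0 : ∫ x, F x ∂(Measure.pi fun _ => ν) = 0)
    (hF1 : ∫ x, F x ^ 2 ∂(Measure.pi fun _ => ν) = 1) :
    ∫ V, pairSum id F V ∂(Measure.pi fun _ => ν.prod ν) = 2 := by
  have hF2 : MemLp F 2 (Measure.pi fun _ => ν) := hF.mono_exponent (by norm_num)
  have h := integral_mul_eq_sum_pathDiff ν hF2 hF2 hF0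
  simp_rw [← sq, hF1] at h
  unfold pairSum
  rw [integral_finsetSum _ fun i _ =>
    (memLp_pair_term hF LipschitzWith.id rfl i).integrable one_le_two]
  simp only [id]
  linarith

/-- Under exchange of the two copies of coordinate `i`, `|D_i|` is invariant and `Δ_i` changes sign.
-/
lemma integral_abs_pathDiff_mul_comp (hF : MemLp F 4 (Measure.pi fun _ => ν)) {H : ℝ → ℝ}
    (hH : Measurable H) (i : ι) :
    ∫ V, |pathDiff F i V| * resampleDiff F i V * H (F (sel {i}ᶜ V))
        ∂(Measure.pi fun _ => ν.prod ν) =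
      -∫ V, |pathDiff F i V| * resampleDiff F i V * H (F (sel Finset.univ V))
        ∂(Measure.pi fun _ => ν.prod ν) := by
  have hm : AEStronglyMeasurable
      (fun V => |pathDiff F i V| * resampleDiff F i V * H (F (sel Finset.univ V)))
      (Measure.pi fun _ => ν.prod ν) :=
    ((memLp_pathDiff ν hF i).abs.1.mul (memLp_resampleDiff ν hF i).1).mul
      (hH.comp_aemeasurable (memLp_comp_sel ν hF _).1.aemeasurable).aestronglyMeasurable
  rw [← integral_comp_measurePreserving (measurePreserving_swapAt ν i) hm, ← integral_neg]
  refine integral_congr_ae (.of_forall fun V => ?_)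
  simp only [pathDiff_swapAt, resampleDiff_swapAt, sel_univ_swapAt, abs_neg]
  ring

lemma lipschitzWith_abs : LipschitzWith 1 (fun x : ℝ => |x|) :=
  lipschitzWith_one_norm

lemma integral_pairSum_abs (hF : MemLp F 4 (Measure.pi fun _ => ν)) :
    ∫ V, pairSum (fun x => |x|) F V ∂(Measure.pi fun _ => ν.prod ν) = 0 := by
  unfold pairSum
  rw [integral_finsetSum _ fun i _ =>
    (memLp_pair_term hF lipschitzWith_abs abs_zero i).integrable one_le_two]
  refine Finset.sum_eq_zero fun i _ => ?_
  have h := integral_abs_pathDiff_mul_comp hF (measurable_const (a := (1 : ℝ))) i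
  simp only [mul_one] at h
  linarith

/-- Stein's method for a function of independent variables. -/
lemma abs_measure_sub_Phi_le_integral (hF : MemLp F 4 (Measure.pi fun _ => ν))
    (hF0 : ∫ x, F x ∂(Measure.pi fun _ => ν) = 0) (z : ℝ) :
    |(Measure.pi fun _ => ν).real {x | F x ≤ z} - Phi z| ≤
      2 * ∫ V, |1 - 1 / 2 * pairSum id F V| ∂(Measure.pi fun _ => ν.prod ν) +
        2 * ∫ V, |pairSum (fun x => |x|) F V| ∂(Measure.pi fun _ => ν.prod ν) := by
  set P := Measure.pi fun _ : ι => ν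
  set Q := Measure.pi fun _ : ι => ν.prod ν
  have hF2 : MemLp F 2 P := hF.mono_exponent (by norm_num)
  have hFm : AEMeasurable F P := hF.1.aemeasurable
  have hFs := fun A => memLp_comp_sel ν hF2 A
  have hFsm := fun A => (hFs A).1.aemeasurable
  have hsol : MemLp (fun x => steinSol z (F x)) 2 P := by
    have hdom1 : MemLp (fun _ : ι → E => |steinSol z 0|) 2 P := memLp_const _
    have hdom2 : MemLp (fun x => 6 * ‖F x‖) 2 P := hF2.norm.const_mul 6
    have hdom := hdom1.add hdom2
    refine hdom.mono
      ((measurable_steinSol z).comp_aemeasurable hFm).aestronglyMeasurable (.of_forall fun x => ?_)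
    exact (abs_steinSol_le z (F x)).trans (le_abs_self _)
  have hder : Integrable (fun x => steinDeriv z (F x)) P := by
    refine Integrable.of_bound
      ((measurable_steinDeriv z).comp_aemeasurable hFm).aestronglyMeasurable 2
      (.of_forall fun x => abs_steinDeriv_le z _)
  have hmul : Integrable (fun x => F x * steinSol z (F x)) P := hF2.integrable_mul hsol
  have hset : NullMeasurableSet {x | F x ≤ z} P :=
    hFm.nullMeasurableSet_preimage measurableSet_Iic
  -- The Stein equation at `w = F(x)`, integrated.
  have hprob : P.real {x | F x ≤ z} - Phi z =
      ∫ x, steinDeriv z (F x) ∂P - ∫ x, F x * steinSol z (F x) ∂P := by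
    rw [← integral_sub hder hmul]
    have h1 : ∀ x, steinDeriv z (F x) - F x * steinSol z (F x) =
        Set.indicator {x | F x ≤ z} (fun _ => (1 : ℝ)) x - Phi z := by
      intro x
      unfold steinDeriv
      by_cases hx : F x ≤ z <;> simp [hx] <;> ring
    simp_rw [h1]
    rw [integral_sub ((integrable_const (1 : ℝ)).indicator₀ hset) (integrable_const _),
      integral_indicator₀ hset]
    simp
  rw [integral_mul_eq_sum_pathDiff ν hF2 hsol hF0] at hprob
  have hT := fun i => (memLp_pair_term (ν := ν) hF LipschitzWith.id rfl i).integrable one_le_two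
  have hA := fun i =>
    (memLp_pair_term (ν := ν) hF lipschitzWith_abs abs_zero i).integrable one_le_two
  have hSid : Integrable (pairSum id F) Q :=
    (memLp_pairSum hF LipschitzWith.id rfl).integrable one_le_two
  have hSabs : Integrable (pairSum (fun x => |x|) F) Q :=
    (memLp_pairSum hF lipschitzWith_abs abs_zero).integrable one_le_two
  have hderm : ∀ A, AEStronglyMeasurable (fun V => steinDeriv z (F (sel A V))) Q := fun A =>
    ((measurable_steinDeriv z).comp_aemeasurable (hFsm A)).aestronglyMeasurable
  have hmonom : ∀ A, AEStronglyMeasurable (fun V => steinMono z (F (sel A V))) Q := fun A =>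
    ((measurable_steinMono z).comp_aemeasurable (hFsm A)).aestronglyMeasurable
  -- The first-order Taylor remainder of the Stein solution along `Δ_i`, weighted by `D_i`.
  let R : ι → (ι → E × E) → ℝ := fun i V => pathDiff F i V *
    (resampleDiff (fun x => steinSol z (F x)) i V -
      steinDeriv z (F (sel Finset.univ V)) * resampleDiff F i V)
  have hTd : ∀ i, Integrable (fun V => pathDiff F i V * resampleDiff F i V *
      steinDeriv z (F (sel Finset.univ V))) Q := fun i =>
    (hT i).mul_bdd (c := 2) (hderm _) (.of_forall fun V => abs_steinDeriv_le z _)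
  have hAm : ∀ i A, Integrable (fun V => |pathDiff F i V| * resampleDiff F i V *
      steinMono z (F (sel A V))) Q := fun i A =>
    (hA i).mul_bdd (c := 2) (hmonom _) (.of_forall fun V => abs_steinMono_le z _)
  have hDf : ∀ i, Integrable
      (fun V => pathDiff F i V * resampleDiff (fun x => steinSol z (F x)) i V) Q := fun i =>
    (memLp_pathDiff ν hF2 i).integrable_mul (memLp_resampleDiff ν hsol i)
  have hR : ∀ i, Integrable (R i) Q := fun i => by
    refine ((hDf i).sub (hTd i)).congr (.of_forall fun V => ?_)
    simp only [R, Pi.sub_apply]; ring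
  have hsplit : ∀ i, ∫ V, pathDiff F i V * resampleDiff (fun x => steinSol z (F x)) i V ∂Q =
      ∫ V, pathDiff F i V * resampleDiff F i V * steinDeriv z (F (sel Finset.univ V)) ∂Q +
        ∫ V, R i V ∂Q := by
    intro i
    rw [← integral_add (hTd i) (hR i)]
    refine integral_congr_ae (.of_forall fun V => ?_)
    simp only [R]; ring
  have hRle : ∀ i, |∫ V, R i V ∂Q| ≤
      2 * ∫ V, |pathDiff F i V| * resampleDiff F i V * steinMono z (F (sel Finset.univ V)) ∂Q := by
    intro i
    refine abs_integral_le_integral_abs.trans ?_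
    have h2 := integral_abs_pathDiff_mul_comp hF (measurable_steinMono z) i
    calc ∫ V, |R i V| ∂Q ≤ ∫ V, (|pathDiff F i V| * resampleDiff F i V *
          steinMono z (F (sel Finset.univ V)) - |pathDiff F i V| * resampleDiff F i V *
          steinMono z (F (sel {i}ᶜ V))) ∂Q := by
          refine integral_mono (hR i).abs ((hAm i _).sub (hAm i _)) fun V => ?_
          have h3 := abs_steinSol_sub_le z (F (sel Finset.univ V)) (F (sel {i}ᶜ V))
          simp only [R, abs_mul]
          calc _ ≤ |pathDiff F i V| * _ := mul_le_mul_of_nonneg_left h3 (abs_nonneg _)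
            _ = _ := by simp only [resampleDiff]; ring
      _ = _ := by
          rw [integral_sub (hAm i _) (hAm i _)]
          linarith
  have hmain : ∫ x, steinDeriv z (F x) ∂P -
      1 / 2 * ∑ i, ∫ V, pathDiff F i V * resampleDiff F i V *
        steinDeriv z (F (sel Finset.univ V)) ∂Q =
      ∫ V, steinDeriv z (F (sel Finset.univ V)) * (1 - 1 / 2 * pairSum id F V) ∂Q := by
    have h1 : ∫ x, steinDeriv z (F x) ∂P = ∫ V, steinDeriv z (F (sel Finset.univ V)) ∂Q :=
      (integral_comp_measurePreserving (measurePreserving_sel ν Finset.univ)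
        (G := fun x => steinDeriv z (F x)) hder.1).symm
    have hi : Integrable (fun V => steinDeriv z (F (sel Finset.univ V))) Q :=
      Integrable.of_bound (hderm _) 2 (.of_forall fun V => abs_steinDeriv_le z _)
    rw [h1, ← integral_finsetSum _ fun i _ => hTd i, ← integral_const_mul,
      ← integral_sub hi ((integrable_finsetSum _ fun i _ => hTd i).const_mul _)]
    refine integral_congr_ae (.of_forall fun V => ?_)
    simp only [pairSum, id, ← Finset.sum_mul]
    ring
  have hmain_le : |∫ V, steinDeriv z (F (sel Finset.univ V)) * (1 - 1 / 2 * pairSum id F V) ∂Q| ≤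
      2 * ∫ V, |1 - 1 / 2 * pairSum id F V| ∂Q := by
    rw [← integral_const_mul]
    have hi : Integrable (fun V => 1 - 1 / 2 * pairSum id F V) Q :=
      (integrable_const _).sub (hSid.const_mul _)
    rw [← Real.norm_eq_abs]
    refine norm_integral_le_of_norm_le (hi.abs.const_mul 2) (.of_forall fun V => ?_)
    rw [Real.norm_eq_abs, abs_mul]
    exact mul_le_mul_of_nonneg_right (abs_steinDeriv_le z _) (abs_nonneg _)
  -- `|g| ≤ 2` is applied only after summing over `i`. The signs of the `Δ_i` are thus kept, and the
  -- centring of `∑ |D_i| Δ_i` can be exploited; termwise absolute values would lose this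
  -- cancellation.
  have hrem_le : ∑ i, ∫ V, |pathDiff F i V| * resampleDiff F i V *
      steinMono z (F (sel Finset.univ V)) ∂Q ≤ 2 * ∫ V, |pairSum (fun x => |x|) F V| ∂Q := by
    rw [← integral_finsetSum _ fun i _ => hAm i _, ← integral_const_mul]
    refine integral_mono (integrable_finsetSum _ fun i _ => hAm i _) (hSabs.abs.const_mul 2)
      fun V => ?_
    simp only [← Finset.sum_mul]
    refine (le_abs_self _).trans ?_
    rw [abs_mul, mul_comm]
    exact mul_le_mul_of_nonneg_right (abs_steinMono_le z _) (abs_nonneg _)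
  have hfinal : P.real {x | F x ≤ z} - Phi z =
      ∫ V, steinDeriv z (F (sel Finset.univ V)) * (1 - 1 / 2 * pairSum id F V) ∂Q -
        1 / 2 * ∑ i, ∫ V, R i V ∂Q := by
    rw [hprob, ← hmain, Finset.sum_congr rfl fun i _ => hsplit i, Finset.sum_add_distrib]
    ring
  have hsumR : |∑ i, ∫ V, R i V ∂Q| ≤ 2 * ∑ i, ∫ V, |pathDiff F i V| * resampleDiff F i V *
      steinMono z (F (sel Finset.univ V)) ∂Q := by
    rw [Finset.mul_sum]
    exact (Finset.abs_sum_le_sum_abs _ _).trans (Finset.sum_le_sum fun i _ => hRle i)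
  rw [hfinal]
  refine (abs_sub _ _).trans ?_
  rw [abs_mul, abs_of_pos (show (0 : ℝ) < 1 / 2 by norm_num)]
  linarith

/-- Normal approximation of a function of i.i.d. variables in terms of the fourth moments of its
first- and second-order differences. -/
theorem abs_measure_sub_Phi_le (hF : MemLp F 4 (Measure.pi fun _ => ν))
    (hF0 : ∫ x, F x ∂(Measure.pi fun _ => ν) = 0)
    (hF1 : ∫ x, F x ^ 2 ∂(Measure.pi fun _ => ν) = 1) {a β : NNReal} {b : ι → ι → NNReal}
    (ha : ∀ i, eLpNorm (resampleDiff F i) 4 (Measure.pi fun _ => ν.prod ν) ≤ a)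
    (hb : ∀ i l, i ≠ l → eLpNorm (mixDiff F i l) 4 (Measure.pi fun _ => ν.prod ν) ≤ b i l)
    (hβ : ∀ l, ∑ i ∈ Finset.univ.erase l, b i l ≤ β) (z : ℝ) :
    |(Measure.pi fun _ => ν).real {x | F x ≤ z} - Phi z| ≤
      6 * (√(Fintype.card ι) * (a * (a + β))) := by
  have key : ∀ {ψ : ℝ → ℝ}, LipschitzWith 1 ψ → ψ 0 = 0 →
      ∫ V, |pairSum ψ F V - ∫ V', pairSum ψ F V' ∂(Measure.pi fun _ => ν.prod ν)|
        ∂(Measure.pi fun _ => ν.prod ν) ≤ 2 * (√(Fintype.card ι) * (a * (a + β))) := by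
    intro ψ hψ hψ0
    refine (integral_abs_sub_mean_le (memLp_pairSum hF hψ hψ0)).trans ?_
    refine Real.sqrt_le_iff.2 ⟨by positivity, ?_⟩
    -- The factor `2` in the variance bound would give `√2`, which is rounded up to `2`.
    refine (variance_pairSum_le hF hψ hψ0 ha hb hβ).trans ?_
    rw [mul_pow 2, mul_pow √_, Real.sq_sqrt (Nat.cast_nonneg _)]
    have : 0 ≤ (Fintype.card ι : ℝ) * ((a : ℝ) * (a + β)) ^ 2 := by positivity
    linarith
  have h1 := key LipschitzWith.id rfl
  have h2 := key lipschitzWith_abs abs_zero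
  rw [integral_pairSum_id hF hF0 hF1] at h1
  rw [integral_pairSum_abs hF] at h2
  simp only [sub_zero] at h2
  have h3 : ∫ V, |1 - 1 / 2 * pairSum id F V| ∂(Measure.pi fun _ => ν.prod ν) =
      1 / 2 * ∫ V, |pairSum id F V - 2| ∂(Measure.pi fun _ => ν.prod ν) := by
    rw [← integral_const_mul]
    refine integral_congr_ae (.of_forall fun V => ?_)
    simp only
    rw [show 1 - 1 / 2 * pairSum id F V = -(1 / 2 * (pairSum id F V - 2)) by ring, abs_neg,
      abs_mul, abs_of_pos (show (0 : ℝ) < 1 / 2 by norm_num)]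
  -- The constant is `2 · ½ · 2 + 2 · 2 = 6`.
  have h4 := abs_measure_sub_Phi_le_integral hF hF0 z
  rw [h3] at h4
  linarith

end SteinMethod

/-! ### Moments of the kernel and of its projection -/

section Kernel

variable {m : ℕ} {P : Measure ℝ} {h : (Fin m → ℝ) → ℝ}

lemma memLp_four_of_integrable_pow {α : Type*} [MeasurableSpace α] {μ : Measure α} {f : α → ℝ}
    (hf : AEStronglyMeasurable f μ) (hi : Integrable (fun x => f x ^ 4) μ) : MemLp f 4 μ := by
  rw [← integrable_norm_rpow_iff hf (by norm_num) (by norm_num)]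
  refine hi.congr (.of_forall fun x => ?_)
  have : (4 : ENNReal).toReal = ((4 : ℕ) : ℝ) := by norm_num
  simp only [this, Real.rpow_natCast, Real.norm_eq_abs]
  rw [Even.pow_abs ⟨2, rfl⟩]

lemma kernelNorm_nonneg : 0 ≤ kernelNorm P h 4 :=
  Real.rpow_nonneg (integral_nonneg fun _ => by positivity) _

lemma eLpNorm_eq_kernelNorm (hh : MemLp h 4 (iidLaw m P)) :
    eLpNorm h 4 (iidLaw m P) = ENNReal.ofReal (kernelNorm P h 4) := by
  rw [hh.eLpNorm_eq_integral_rpow_norm (by norm_num) (by norm_num), kernelNorm]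
  have : (4 : ENNReal).toReal = ((4 : ℕ) : ℝ) := by norm_num
  simp only [this, Real.rpow_natCast, Real.norm_eq_abs, one_div]

lemma sigmaOne_sq [NeZero m] (h : (Fin m → ℝ) → ℝ) :
    sigmaOne P h ^ 2 = ∫ x, projection P h x ^ 2 ∂P :=
  Real.sq_sqrt (integral_nonneg fun _ => sq_nonneg _)

variable [IsProbabilityMeasure P]

lemma measurePreserving_comp_injective {ι κ : Type*} [Fintype ι] [Fintype κ] {e : κ → ι}
    (he : Function.Injective e) :
    MeasurePreserving (fun x : ι → ℝ => x ∘ e) (Measure.pi fun _ => P) (Measure.pi fun _ => P) := by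
  have hm : Measurable (fun x : ι → ℝ => x ∘ e) :=
    measurable_pi_lambda _ fun l => measurable_pi_apply (e l)
  refine ⟨hm, ?_⟩
  have h1 : iIndepFun (fun (i : ι) (x : ι → ℝ) => x i) (Measure.pi fun _ => P) :=
    iIndepFun_pi (μ := fun _ : ι => P) (X := fun _ x => x) fun i => aemeasurable_id
  have h2 := (iIndepFun_iff_map_fun_eq_pi_map
    (fun l => (measurable_pi_apply (e l)).aemeasurable)).1 (h1.precomp he)
  have h3 : ∀ i : ι, Measure.map (fun x : ι → ℝ => x i) (Measure.pi fun _ => P) = P := fun i =>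
    (measurePreserving_eval (fun _ : ι => P) i).map_eq
  simp_rw [h3] at h2
  exact h2

lemma measurePreserving_eval_iidLaw (l : Fin m) :
    MeasurePreserving (fun y : Fin m → ℝ => y l) (iidLaw m P) P :=
  measurePreserving_eval (fun _ => P) l

variable [NeZero m]

/-- The `σ`-algebra of the first coordinate. -/
abbrev firstCoord (m : ℕ) [NeZero m] : MeasurableSpace (Fin m → ℝ) :=
  MeasurableSpace.comap (fun y : Fin m → ℝ => y 0) inferInstance

lemma firstCoord_le : firstCoord m ≤ MeasurableSpace.pi := (measurable_pi_apply 0).comap_le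

lemma stronglyMeasurable_projection (hh : Measurable h) : StronglyMeasurable (projection P h) := by
  unfold projection
  refine StronglyMeasurable.integral_prod_right' (ν := iidLaw m P)
    (f := fun p : ℝ × (Fin m → ℝ) => h (Function.update p.2 0 p.1) - theta P h) ?_
  exact ((hh.comp (measurePreserving_update (m := m) P).measurable).sub_const _).stronglyMeasurable

lemma memLp_projection_zero (hh : Measurable h) (hh2 : MemLp h 2 (iidLaw m P)) :
    MemLp (fun y : Fin m → ℝ => projection P h (y 0)) 2 (iidLaw m P) := by
  have h1 : MemLp (fun y => h y - theta P h) 2 (iidLaw m P) := hh2.sub (memLp_const _)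
  exact (h1.condExp (m := firstCoord m) one_le_two).ae_eq
    (projection_ae_eq_condExp P h hh (hh2.integrable one_le_two)).symm

lemma memLp_projection (hh : Measurable h) (hh2 : MemLp h 2 (iidLaw m P)) :
    MemLp (projection P h) 2 P := by
  have h1 := (memLp_map_measure_iff (μ := iidLaw m P) (g := projection P h)
    (stronglyMeasurable_projection hh).aestronglyMeasurable
    (measurable_pi_apply (0 : Fin m)).aemeasurable).2 (memLp_projection_zero hh hh2)
  rwa [(measurePreserving_eval_iidLaw (P := P) (0 : Fin m)).map_eq] at h1

lemma integral_projection (hh : Measurable h) (hh2 : MemLp h 2 (iidLaw m P)) :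
    ∫ x, projection P h x ∂P = 0 := by
  rw [← integral_comp_measurePreserving (measurePreserving_eval_iidLaw (P := P) (0 : Fin m))
    (stronglyMeasurable_projection hh).aestronglyMeasurable,
    integral_congr_ae (projection_ae_eq_condExp P h hh (hh2.integrable one_le_two)),
    integral_condExp firstCoord_le,
    integral_sub (hh2.integrable one_le_two) (integrable_const _)]
  simp [theta]

/-- `g` of the first coordinate is a conditional expectation and can be pulled out, leaving `E g²`.
-/
lemma integral_kernel_mul_projection_zero (hh : Measurable h) (hh2 : MemLp h 2 (iidLaw m P)) :
    ∫ y, (h y - theta P h) * projection P h (y 0) ∂(iidLaw m P) = sigmaOne P h ^ 2 := by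
  have h1 : MemLp (fun y => h y - theta P h) 2 (iidLaw m P) := hh2.sub (memLp_const _)
  have h2 := memLp_projection_zero hh hh2
  have hsm : StronglyMeasurable[firstCoord m] (fun y : Fin m → ℝ => projection P h (y 0)) :=
    (stronglyMeasurable_projection hh).comp_measurable (comap_measurable _)
  have h3 := condExp_mul_of_stronglyMeasurable_right hsm (h1.integrable_mul h2)
    (h1.integrable one_le_two)
  have h4 := projection_ae_eq_condExp P h hh (hh2.integrable one_le_two)
  have h5 : ∫ y, (h y - theta P h) * projection P h (y 0) ∂(iidLaw m P) =
      ∫ y, projection P h (y 0) ^ 2 ∂(iidLaw m P) := by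
    rw [← integral_condExp (firstCoord_le (m := m)) (μ := iidLaw m P)]
    refine integral_congr_ae ?_
    filter_upwards [h3, h4] with y h3 h4
    rw [sq]
    nth_rw 1 [h4]
    exact h3
  rw [h5, sigmaOne_sq]
  exact integral_comp_measurePreserving (measurePreserving_eval_iidLaw (P := P) (0 : Fin m))
    (G := fun x => projection P h x ^ 2)
    ((stronglyMeasurable_projection hh).pow 2).aestronglyMeasurable

/-- The projection is defined through the first coordinate; symmetry of `h` transports the identity
to every other one by a transposition. -/
lemma integral_kernel_mul_projection (hh : Measurable h) (hsym : IsSymmetricKernel h)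
    (hh2 : MemLp h 2 (iidLaw m P)) (l : Fin m) :
    ∫ y, (h y - theta P h) * projection P h (y l) ∂(iidLaw m P) = sigmaOne P h ^ 2 := by
  rw [← integral_kernel_mul_projection_zero hh hh2]
  have hmeas : Measurable fun y : Fin m → ℝ => (h y - theta P h) * projection P h (y 0) :=
    (hh.sub_const _).mul ((stronglyMeasurable_projection hh).measurable.comp (measurable_pi_apply 0))
  have hT : MeasurePreserving (fun y : Fin m → ℝ => y ∘ Equiv.swap 0 l) (iidLaw m P)
      (iidLaw m P) := measurePreserving_comp_injective (Equiv.swap 0 l).injective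
  rw [← integral_comp_measurePreserving hT hmeas.aestronglyMeasurable]
  refine integral_congr_ae (.of_forall fun y => ?_)
  simp [hsym (Equiv.swap 0 l) y]

lemma integral_sq_le_kernelNorm_sq (hh4 : MemLp h 4 (iidLaw m P)) :
    ∫ y, h y ^ 2 ∂(iidLaw m P) ≤ kernelNorm P h 4 ^ 2 := by
  have h2 : MemLp h 2 (iidLaw m P) := hh4.mono_exponent (by norm_num)
  refine integral_sq_le_of_eLpNorm_le (c := ⟨kernelNorm P h 4, kernelNorm_nonneg⟩) h2 ?_
  have h24 : (2 : ENNReal) ≤ 4 := by norm_num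
  refine (eLpNorm_le_eLpNorm_of_exponent_le h24 hh4.1).trans ?_
  rw [eLpNorm_eq_kernelNorm hh4, ENNReal.ofReal_eq_coe_nnreal kernelNorm_nonneg]
  exact le_rfl

/-- From `σ₁² = E[(h - θ) g] ≤ ½ Var h + ½ σ₁²` one gets `σ₁² ≤ Var h ≤ E h² ≤ ‖h‖₄²`. -/
lemma sigmaOne_le_kernelNorm (hh : Measurable h) (hh4 : MemLp h 4 (iidLaw m P)) :
    sigmaOne P h ≤ kernelNorm P h 4 := by
  have hh2 : MemLp h 2 (iidLaw m P) := hh4.mono_exponent (by norm_num)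
  have h1 : MemLp (fun y => h y - theta P h) 2 (iidLaw m P) := hh2.sub (memLp_const _)
  have h2 := memLp_projection_zero hh hh2
  refine (sq_le_sq₀ (Real.sqrt_nonneg _) kernelNorm_nonneg).1 ?_
  refine le_trans ?_ (integral_sq_le_kernelNorm_sq hh4)
  have h3 := integral_kernel_mul_projection_zero hh hh2
  have h4 : ∫ y, projection P h (y 0) ^ 2 ∂(iidLaw m P) = sigmaOne P h ^ 2 := by
    rw [sigmaOne_sq]
    exact integral_comp_measurePreserving (measurePreserving_eval_iidLaw (P := P) (0 : Fin m))
      (G := fun x => projection P h x ^ 2)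
      ((stronglyMeasurable_projection hh).pow 2).aestronglyMeasurable
  have h5 : ∫ y, (h y - theta P h) * projection P h (y 0) ∂(iidLaw m P) ≤
      ∫ y, (1 / 2 * (h y - theta P h) ^ 2 + 1 / 2 * projection P h (y 0) ^ 2) ∂(iidLaw m P) := by
    refine integral_mono (h1.integrable_mul h2)
      ((h1.integrable_sq.const_mul _).add (h2.integrable_sq.const_mul _)) fun y => ?_
    simp only
    nlinarith [sq_nonneg ((h y - theta P h) - projection P h (y 0))]
  rw [integral_add (h1.integrable_sq.const_mul _) (h2.integrable_sq.const_mul _),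
    integral_const_mul, integral_const_mul, h3, h4] at h5
  have h6 : ∫ y, (h y - theta P h) ^ 2 ∂(iidLaw m P) ≤ ∫ y, h y ^ 2 ∂(iidLaw m P) := by
    have h7 := variance_eq_sub hh2
    rw [variance_eq_integral hh.aemeasurable] at h7
    have h8 : ∫ y, (h ^ 2) y ∂(iidLaw m P) = ∫ y, h y ^ 2 ∂(iidLaw m P) := rfl
    rw [h8] at h7
    have h9 := sq_nonneg (∫ y, h y ∂(iidLaw m P))
    change ∫ y, (h y - ∫ y', h y' ∂(iidLaw m P)) ^ 2 ∂(iidLaw m P) ≤ _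
    linarith
  change sigmaOne P h ^ 2 ≤ _
  linarith

end Kernel

/-! ### Weighted U-statistics: weights, mean and variance -/

section WeightedUStat

variable {ι T : Type*} {m : ℕ} {P : Measure ℝ} {h : (Fin m → ℝ) → ℝ}

/-- The weighted sum of the kernel `h` over the index tuples `κ q`, `q ∈ K`. -/
def weightedUStat (K : Finset T) (κ : T → Fin m → ι) (c : T → ℝ) (h : (Fin m → ℝ) → ℝ)
    (x : ι → ℝ) : ℝ :=
  ∑ q ∈ K, c q * h (x ∘ κ q)

variable {K : Finset T} {κ : T → Fin m → ι} {c : T → ℝ}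

lemma measurable_weightedUStat (hh : Measurable h) : Measurable (weightedUStat K κ c h) :=
  Finset.measurable_fun_sum _ fun q _ => (hh.comp
    (measurable_pi_lambda _ fun l => measurable_pi_apply (κ q l))).const_mul (c q)

variable [Fintype ι] [IsProbabilityMeasure P]

lemma memLp_weightedUStat {p : ENNReal} (hκ : ∀ q ∈ K, Function.Injective (κ q))
    (hp : MemLp h p (iidLaw m P)) :
    MemLp (weightedUStat K κ c h) p (Measure.pi fun _ => P) :=
  memLp_finsetSum _ fun q hq =>
    (hp.comp_measurePreserving (measurePreserving_comp_injective (hκ q hq))).const_mul (c q)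

lemma integral_weightedUStat (hκ : ∀ q ∈ K, Function.Injective (κ q))
    (hi : Integrable h (iidLaw m P)) :
    ∫ x, weightedUStat K κ c h x ∂(Measure.pi fun _ => P) = (∑ q ∈ K, c q) * theta P h := by
  have hmp := fun q hq => measurePreserving_comp_injective (P := P) (hκ q hq)
  have hint : ∀ q ∈ K, Integrable (fun x => c q * h (x ∘ κ q)) (Measure.pi fun _ => P) :=
    fun q hq => ((hmp q hq).integrable_comp_of_integrable hi).const_mul (c q)
  unfold weightedUStat
  rw [integral_finsetSum _ hint, Finset.sum_mul]
  refine Finset.sum_congr rfl fun q hq => ?_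
  rw [integral_const_mul, integral_comp_measurePreserving (hmp q hq) hi.1]
  rfl

variable [DecidableEq ι]

/-- Double counting of incidences: each tuple contains exactly `m` indices. -/
lemma sum_weights_eq (hκ : ∀ q ∈ K, Function.Injective (κ q)) {w : ℝ}
    (hw : ∀ p, ∑ q ∈ K with p ∈ Finset.univ.image (κ q), c q = w) :
    (m : ℝ) * ∑ q ∈ K, c q = Fintype.card ι * w := by
  have h1 : ∑ p : ι, ∑ q ∈ K with p ∈ Finset.univ.image (κ q), c q = Fintype.card ι * w := by
    simp_rw [hw]
    rw [Finset.sum_const, Finset.card_univ, nsmul_eq_mul]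
  rw [← h1]
  simp_rw [Finset.sum_filter]
  rw [Finset.sum_comm, Finset.mul_sum]
  refine Finset.sum_congr rfl fun q hq => ?_
  rw [← Finset.sum_filter, Finset.sum_const, nsmul_eq_mul, Finset.filter_univ_mem,
    Finset.card_image_of_injective _ (hκ q hq), Finset.card_univ, Fintype.card_fin]

/-- Each tuple through `p` contains `m - 1` further indices. This is where the row sums of
second-order differences acquire their factor `m - 1`. -/
lemma sum_pair_weights_eq (hκ : ∀ q ∈ K, Function.Injective (κ q)) {w : ℝ}
    (hw : ∀ p, ∑ q ∈ K with p ∈ Finset.univ.image (κ q), c q = w) (p : ι) :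
    ∑ p' ∈ Finset.univ.erase p, ∑ q ∈ K with
      p' ∈ Finset.univ.image (κ q) ∧ p ∈ Finset.univ.image (κ q), c q = ((m : ℝ) - 1) * w := by
  rw [← hw p, Finset.mul_sum]
  simp_rw [Finset.sum_filter]
  rw [Finset.sum_comm]
  refine Finset.sum_congr rfl fun q hq => ?_
  by_cases hp : p ∈ Finset.univ.image (κ q)
  · simp only [hp, and_true, if_true]
    rw [← Finset.sum_filter, Finset.sum_const, nsmul_eq_mul]
    congr 1
    have h1 : (Finset.univ.erase p).filter (fun p' => p' ∈ Finset.univ.image (κ q)) =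
        (Finset.univ.image (κ q)).erase p := by
      ext p'; simp [and_comm]
    have hpos : 1 ≤ (Finset.univ.image (κ q)).card := Finset.card_pos.2 ⟨p, hp⟩
    rw [h1, Finset.card_erase_of_mem hp, Nat.cast_sub hpos,
      Finset.card_image_of_injective _ (hκ q hq), Finset.card_univ, Fintype.card_fin]
    simp
  · simp [hp]

variable [NeZero m]

/-- If `p` is not an index of the tuple, the two factors are independent and the projection is
centred. -/
lemma integral_kernel_comp_mul_projection (hh : Measurable h) (hsym : IsSymmetricKernel h)
    (hh2 : MemLp h 2 (iidLaw m P)) {e : Fin m → ι} (he : Function.Injective e) (p : ι) :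
    ∫ x, (h (x ∘ e) - theta P h) * projection P h (x p) ∂(Measure.pi fun _ => P) =
      if p ∈ Finset.univ.image e then sigmaOne P h ^ 2 else 0 := by
  have hg := stronglyMeasurable_projection (P := P) hh
  split_ifs with hp
  · obtain ⟨l, -, rfl⟩ := Finset.mem_image.1 hp
    rw [← integral_kernel_mul_projection hh hsym hh2 l]
    have hmeas : Measurable fun y : Fin m → ℝ => (h y - theta P h) * projection P h (y l) :=
      (hh.sub_const _).mul (hg.measurable.comp (measurable_pi_apply l))
    exact integral_comp_measurePreserving (measurePreserving_comp_injective (P := P) he)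
      (G := fun y : Fin m → ℝ => (h y - theta P h) * projection P h (y l))
      hmeas.aestronglyMeasurable
  · have h1 : iIndepFun (fun (i : ι) (x : ι → ℝ) => x i) (Measure.pi fun _ => P) :=
      iIndepFun_pi (μ := fun _ : ι => P) (X := fun _ x => x) fun i => aemeasurable_id
    have h2 := h1.indepFun_finset (Finset.univ.image e) {p} (by simpa using hp)
      fun i => measurable_pi_apply i
    have hm1 : Measurable fun (y : ↥(Finset.univ.image e) → ℝ) =>
        h (fun l => y ⟨e l, Finset.mem_image_of_mem e (Finset.mem_univ l)⟩) - theta P h :=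
      (hh.comp (measurable_pi_lambda _ fun l => measurable_pi_apply _)).sub_const _
    have hm2 : Measurable fun (y : ↥({p} : Finset ι) → ℝ) =>
        projection P h (y ⟨p, Finset.mem_singleton_self p⟩) :=
      hg.measurable.comp (measurable_pi_apply _)
    have h3 : IndepFun (fun x : ι → ℝ => h (x ∘ e) - theta P h)
        (fun x => projection P h (x p)) (Measure.pi fun _ => P) := h2.comp hm1 hm2
    have hme : Measurable (fun x : ι → ℝ => x ∘ e) :=
      measurable_pi_lambda _ fun l => measurable_pi_apply (e l)
    rw [h3.integral_fun_mul_eq_mul_integral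
      ((hh.comp hme).sub_const _).aestronglyMeasurable
      (hg.comp_measurable (measurable_pi_apply p)).aestronglyMeasurable,
      integral_comp_measurePreserving (measurePreserving_eval (fun _ : ι => P) p)
        hg.aestronglyMeasurable, integral_projection hh hh2, mul_zero]

/-- The variance of a weighted U-statistic is at least that of its Hájek projection. -/
lemma sq_sigmaOne_le_variance_weightedUStat (hh : Measurable h) (hsym : IsSymmetricKernel h)
    (hh2 : MemLp h 2 (iidLaw m P)) (hκ : ∀ q ∈ K, Function.Injective (κ q))
    (hc1 : ∑ q ∈ K, c q = 1) [Nonempty ι] :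
    (m : ℝ) ^ 2 * sigmaOne P h ^ 2 / Fintype.card ι ≤
      Var[weightedUStat K κ c h; Measure.pi fun _ => P] := by
  set Q := Measure.pi fun _ : ι => P
  have hg := stronglyMeasurable_projection (P := P) hh
  have hU : MemLp (weightedUStat K κ c h) 2 Q := memLp_weightedUStat hκ hh2
  have hY : MemLp (fun x => weightedUStat K κ c h x - theta P h) 2 Q := hU.sub (memLp_const _)
  have hgp : ∀ p : ι, MemLp (fun x : ι → ℝ => projection P h (x p)) 2 Q := fun p =>
    (memLp_projection hh hh2).comp_measurePreserving (measurePreserving_eval (fun _ : ι => P) p)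
  have hL : MemLp (fun x : ι → ℝ => ∑ p, projection P h (x p)) 2 Q :=
    memLp_finsetSum _ fun p _ => hgp p
  have hLsq : ∫ x, (∑ p, projection P h (x p)) ^ 2 ∂Q = Fintype.card ι * sigmaOne P h ^ 2 := by
    have h1 := variance_sum_pi (ι := ι) (μ := fun _ => P) (X := fun _ => projection P h)
      fun _ => memLp_projection hh hh2
    have h2 : ∫ x, (∑ p, projection P h (x p)) ∂Q = 0 := by
      rw [integral_finsetSum _ fun p _ => (hgp p).integrable one_le_two]
      refine Finset.sum_eq_zero fun p _ => ?_
      rw [integral_comp_measurePreserving (measurePreserving_eval (fun _ : ι => P) p)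
        hg.aestronglyMeasurable, integral_projection hh hh2]
    have h3 : Var[projection P h; P] = sigmaOne P h ^ 2 := by
      rw [variance_of_integral_eq_zero hg.aestronglyMeasurable.aemeasurable
        (integral_projection hh hh2), sigmaOne_sq]
    have h4 : (∑ p : ι, fun x : ι → ℝ => projection P h (x p)) =
        fun x => ∑ p, projection P h (x p) := by
      funext x; simp
    rw [h4, variance_of_integral_eq_zero hL.1.aemeasurable h2] at h1
    rw [h1]
    simp [h3]
  have hcross : ∫ x, (weightedUStat K κ c h x - theta P h) * ∑ p, projection P h (x p) ∂Q =
      m * sigmaOne P h ^ 2 := by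
    have hk : ∀ q ∈ K, MemLp (fun x : ι → ℝ => h (x ∘ κ q) - theta P h) 2 Q := fun q hq =>
      (hh2.comp_measurePreserving (measurePreserving_comp_injective (hκ q hq))).sub (memLp_const _)
    have hexp : ∀ x, (weightedUStat K κ c h x - theta P h) * ∑ p, projection P h (x p) =
        ∑ q ∈ K, ∑ p, c q * ((h (x ∘ κ q) - theta P h) * projection P h (x p)) := by
      intro x
      have h1 : weightedUStat K κ c h x - theta P h =
          ∑ q ∈ K, c q * (h (x ∘ κ q) - theta P h) := by
        simp_rw [mul_sub, Finset.sum_sub_distrib, ← Finset.sum_mul, hc1, one_mul]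
        rfl
      rw [h1, Finset.sum_mul]
      refine Finset.sum_congr rfl fun q _ => ?_
      rw [Finset.mul_sum]
      exact Finset.sum_congr rfl fun p _ => by ring
    have hint : ∀ q ∈ K, ∀ p : ι, Integrable
        (fun x => c q * ((h (x ∘ κ q) - theta P h) * projection P h (x p))) Q := fun q hq p =>
      ((hk q hq).integrable_mul (hgp p)).const_mul (c q)
    simp_rw [hexp]
    rw [integral_finsetSum _ fun q hq => integrable_finsetSum _ fun p _ => hint q hq p]
    calc _ = ∑ q ∈ K, c q * (m * sigmaOne P h ^ 2) := by
          refine Finset.sum_congr rfl fun q hq => ?_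
          rw [integral_finsetSum _ fun p _ => hint q hq p]
          simp_rw [integral_const_mul, Q, integral_kernel_comp_mul_projection hh hsym hh2 (hκ q hq)]
          rw [← Finset.mul_sum, ← Finset.sum_filter, Finset.sum_const, nsmul_eq_mul,
            Finset.filter_univ_mem, Finset.card_image_of_injective _ (hκ q hq), Finset.card_univ,
            Fintype.card_fin]
      _ = _ := by rw [← Finset.sum_mul, hc1, one_mul]
  have hmean : ∫ x, weightedUStat K κ c h x ∂Q = theta P h := by
    rw [integral_weightedUStat hκ (hh2.integrable one_le_two), hc1, one_mul]
  rw [variance_eq_integral hU.1.aemeasurable, hmean]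
  have hN : (0 : ℝ) < Fintype.card ι := Nat.cast_pos.2 Fintype.card_pos
  -- The least-squares coefficient `Cov(Y, L) / Var L` for the centred statistic `Y` and `L = ∑
  -- g(x_p)`; expanding `(Y - tL)² ≥ 0` gives the bound.
  set t : ℝ := m / Fintype.card ι
  have hYL : Integrable (fun x => (weightedUStat K κ c h x - theta P h) *
      ∑ p, projection P h (x p)) Q := hY.integrable_mul hL
  have hle : ∫ x, (2 * t * ((weightedUStat K κ c h x - theta P h) * ∑ p, projection P h (x p)) -
      t ^ 2 * (∑ p, projection P h (x p)) ^ 2) ∂Q ≤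
      ∫ x, (weightedUStat K κ c h x - theta P h) ^ 2 ∂Q := by
    refine integral_mono ((hYL.const_mul _).sub (hL.integrable_sq.const_mul _))
      hY.integrable_sq fun x => ?_
    simp only
    nlinarith [sq_nonneg ((weightedUStat K κ c h x - theta P h) - t * ∑ p, projection P h (x p))]
  rw [integral_sub (hYL.const_mul _) (hL.integrable_sq.const_mul _),
    integral_const_mul, integral_const_mul, hcross, hLsq] at hle
  refine le_trans (le_of_eq ?_) hle
  simp only [t]
  field_simp
  ring

end WeightedUStat

/-! ### Differences of weighted U-statistics and their Berry–Esseen bound -/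

lemma eLpNorm_sum_const_mul_le {α T : Type*} [MeasurableSpace α] {μ : Measure α} {S : Finset T}
    {c : T → ℝ} {f : T → α → ℝ} (hf : ∀ q ∈ S, AEStronglyMeasurable (f q) μ)
    (hc : ∀ q ∈ S, 0 ≤ c q) {B : ℝ}
    (hB : ∀ q ∈ S, eLpNorm (f q) 4 μ ≤ ENNReal.ofReal B) :
    eLpNorm (fun x => ∑ q ∈ S, c q * f q x) 4 μ ≤ ENNReal.ofReal ((∑ q ∈ S, c q) * B) := by
  have heq : (fun x => ∑ q ∈ S, c q * f q x) = ∑ q ∈ S, fun x => c q * f q x := by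
    funext x; simp
  rw [heq]
  refine (eLpNorm_sum_le (fun q hq => (hf q hq).const_mul _) (by norm_num)).trans ?_
  rw [ENNReal.ofReal_mul (Finset.sum_nonneg hc), ENNReal.ofReal_sum_of_nonneg hc, Finset.sum_mul]
  refine Finset.sum_le_sum fun q hq => ?_
  have h1 : eLpNorm (fun x => c q * f q x) 4 μ = ENNReal.ofReal (c q) * eLpNorm (f q) 4 μ := by
    have := eLpNorm_const_smul (c q) (f q) 4 μ
    rw [Real.enorm_of_nonneg (hc q hq)] at this
    exact this
  rw [h1]
  exact mul_le_mul_right (hB q hq) _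

section WeightedUStatBound

variable {ι T : Type*} {m : ℕ} {P : Measure ℝ} {h : (Fin m → ℝ) → ℝ} {K : Finset T}
  {κ : T → Fin m → ι} {c : T → ℝ} [DecidableEq ι]

lemma sel_comp_congr {A B : Finset ι} {e : Fin m → ι} (hAB : ∀ l, e l ∈ A ↔ e l ∈ B)
    (V : ι → ℝ × ℝ) : sel A V ∘ e = sel B V ∘ e := by
  funext l
  simp [sel, hAB l]

variable [Fintype ι]

/-- Tuples that avoid `p` do not see the resampling, so their terms cancel. -/
lemma resampleDiff_weightedUStat (p : ι) (V : ι → ℝ × ℝ) :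
    resampleDiff (weightedUStat K κ c h) p V = ∑ q ∈ K with p ∈ Finset.univ.image (κ q),
      c q * (h (sel Finset.univ V ∘ κ q) - h (sel {p}ᶜ V ∘ κ q)) := by
  rw [Finset.sum_filter, resampleDiff, weightedUStat, weightedUStat, ← Finset.sum_sub_distrib]
  refine Finset.sum_congr rfl fun q _ => ?_
  split_ifs with hp
  · ring
  · rw [sel_comp_congr (A := Finset.univ) (B := {p}ᶜ), sub_self]
    intro l
    simp only [Finset.mem_univ, Finset.mem_compl, Finset.mem_singleton, true_iff]
    rintro rfl
    exact hp (Finset.mem_image_of_mem _ (Finset.mem_univ l))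

/-- A tuple that misses `p` or `p'` contributes two cancelling pairs, so only tuples through both
remain. -/
lemma mixDiff_weightedUStat (p p' : ι) (V : ι → ℝ × ℝ) :
    mixDiff (weightedUStat K κ c h) p p' V =
      ∑ q ∈ K with p ∈ Finset.univ.image (κ q) ∧ p' ∈ Finset.univ.image (κ q),
        c q * ((h (sel Finset.univ V ∘ κ q) - h (sel {p}ᶜ V ∘ κ q)) -
          (h (sel {p'}ᶜ V ∘ κ q) - h (sel {p, p'}ᶜ V ∘ κ q))) := by
  rw [Finset.sum_filter, mixDiff, weightedUStat, weightedUStat, weightedUStat, weightedUStat,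
    ← Finset.sum_sub_distrib, ← Finset.sum_sub_distrib, ← Finset.sum_add_distrib]
  refine Finset.sum_congr rfl fun q _ => ?_
  split_ifs with hp
  · ring
  · rw [not_and_or] at hp
    rcases hp with hp | hp
    · have hne : ∀ l, κ q l ≠ p := fun l hl => hp (hl ▸ Finset.mem_image_of_mem _ (Finset.mem_univ l))
      rw [sel_comp_congr (A := Finset.univ) (B := {p}ᶜ) (by simp [hne]),
        sel_comp_congr (A := {p'}ᶜ) (B := {p, p'}ᶜ) (by simp [hne])]
      ring
    · have hne : ∀ l, κ q l ≠ p' := fun l hl =>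
        hp (hl ▸ Finset.mem_image_of_mem _ (Finset.mem_univ l))
      rw [sel_comp_congr (A := Finset.univ) (B := {p'}ᶜ) (by simp [hne]),
        sel_comp_congr (A := {p}ᶜ) (B := {p, p'}ᶜ) (by simp [hne])]
      ring

variable [IsProbabilityMeasure P]

lemma memLp_kernel_sel (hh : MemLp h 4 (iidLaw m P)) {e : Fin m → ι} (he : Function.Injective e) (A : Finset ι) :
    MemLp (fun V => h (sel A V ∘ e)) 4 (Measure.pi fun _ => P.prod P) :=
  memLp_comp_sel P (F := fun x => h (x ∘ e))
    (hh.comp_measurePreserving (measurePreserving_comp_injective he)) A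

lemma eLpNorm_kernel_sel (hh : MemLp h 4 (iidLaw m P)) {e : Fin m → ι} (he : Function.Injective e) (A : Finset ι) :
    eLpNorm (fun V => h (sel A V ∘ e)) 4 (Measure.pi fun _ => P.prod P) =
      ENNReal.ofReal (kernelNorm P h 4) := by
  have hmp : MeasurePreserving (fun x : ι → ℝ => x ∘ e) (Measure.pi fun _ => P) (iidLaw m P) :=
    measurePreserving_comp_injective he
  rw [← eLpNorm_eq_kernelNorm hh]
  exact eLpNorm_fun_comp hh.1 (hmp.comp (measurePreserving_sel P A))

lemma eLpNorm_kernel_sel_sub_le (hh : MemLp h 4 (iidLaw m P)) {e : Fin m → ι} (he : Function.Injective e) (A B : Finset ι) :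
    eLpNorm (fun V => h (sel A V ∘ e) - h (sel B V ∘ e)) 4 (Measure.pi fun _ => P.prod P) ≤
      ENNReal.ofReal (2 * kernelNorm P h 4) := by
  refine (eLpNorm_sub_le (memLp_kernel_sel hh he A).1 (memLp_kernel_sel hh he B).1
    (by norm_num)).trans ?_
  rw [eLpNorm_kernel_sel hh he, eLpNorm_kernel_sel hh he,
    ← ENNReal.ofReal_add kernelNorm_nonneg kernelNorm_nonneg, two_mul]

lemma eLpNorm_resampleDiff_weightedUStat_le (hh : MemLp h 4 (iidLaw m P)) (hκ : ∀ q ∈ K, Function.Injective (κ q))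
    (hc : ∀ q ∈ K, 0 ≤ c q) (p : ι) :
    eLpNorm (resampleDiff (weightedUStat K κ c h) p) 4 (Measure.pi fun _ => P.prod P) ≤
      ENNReal.ofReal ((∑ q ∈ K with p ∈ Finset.univ.image (κ q), c q) *
        (2 * kernelNorm P h 4)) := by
  rw [funext (resampleDiff_weightedUStat p)]
  refine eLpNorm_sum_const_mul_le
    (f := fun q V => h (sel Finset.univ V ∘ κ q) - h (sel {p}ᶜ V ∘ κ q))
    (fun q hq => ?_) (fun q hq => hc q (Finset.mem_filter.1 hq).1) fun q hq => ?_
  · have he := hκ q (Finset.mem_filter.1 hq).1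
    exact (memLp_kernel_sel hh he _).1.sub (memLp_kernel_sel hh he _).1
  · exact eLpNorm_kernel_sel_sub_le hh (hκ q (Finset.mem_filter.1 hq).1) _ _

lemma eLpNorm_mixDiff_weightedUStat_le (hh : MemLp h 4 (iidLaw m P)) (hκ : ∀ q ∈ K, Function.Injective (κ q))
    (hc : ∀ q ∈ K, 0 ≤ c q) (p p' : ι) :
    eLpNorm (mixDiff (weightedUStat K κ c h) p p') 4 (Measure.pi fun _ => P.prod P) ≤
      ENNReal.ofReal ((∑ q ∈ K with
        p ∈ Finset.univ.image (κ q) ∧ p' ∈ Finset.univ.image (κ q), c q) *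
        (4 * kernelNorm P h 4)) := by
  rw [funext (mixDiff_weightedUStat p p')]
  have hm := fun q (hq : q ∈ K) A B =>
    (memLp_kernel_sel hh (hκ q hq) A).1.sub (memLp_kernel_sel hh (hκ q hq) B).1
  refine eLpNorm_sum_const_mul_le
    (f := fun q V => (h (sel Finset.univ V ∘ κ q) - h (sel {p}ᶜ V ∘ κ q)) -
      (h (sel {p'}ᶜ V ∘ κ q) - h (sel {p, p'}ᶜ V ∘ κ q)))
    (fun q hq => ?_) (fun q hq => hc q (Finset.mem_filter.1 hq).1) fun q hq => ?_
  · have hq' := (Finset.mem_filter.1 hq).1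
    exact (hm q hq' _ _).sub (hm q hq' _ _)
  · have hq' := (Finset.mem_filter.1 hq).1
    refine (eLpNorm_sub_le (hm q hq' _ _) (hm q hq' _ _) (by norm_num)).trans ?_
    refine (add_le_add (eLpNorm_kernel_sel_sub_le hh (hκ q hq') _ _)
      (eLpNorm_kernel_sel_sub_le hh (hκ q hq') _ _)).trans (le_of_eq ?_)
    have := kernelNorm_nonneg (P := P) (h := h)
    rw [← ENNReal.ofReal_add (by positivity) (by positivity)]
    congr 1; ring

variable [NeZero m] [Nonempty ι]

/-- A Berry–Esseen bound for weighted U-statistics in which all observations have the same total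
weight. -/
theorem weightedUStat_berryEsseen (hh : MemLp h 4 (iidLaw m P)) (hmeas : Measurable h) (hsym : IsSymmetricKernel h)
    (hσ : 0 < sigmaOne P h) (hκ : ∀ q ∈ K, Function.Injective (κ q)) (hc : ∀ q ∈ K, 0 ≤ c q)
    (hw : ∀ p, ∑ q ∈ K with p ∈ Finset.univ.image (κ q), c q = (m : ℝ) / Fintype.card ι) (z : ℝ) :
    |(Measure.pi fun _ => P).real {x | (weightedUStat K κ c h x - theta P h) /
        √(Var[weightedUStat K κ c h; Measure.pi fun _ => P]) ≤ z} - Phi z| ≤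
      48 * m / √(Fintype.card ι) * (kernelNorm P h 4 ^ 3 / sigmaOne P h ^ 3) := by
  set s := √(Var[weightedUStat K κ c h; Measure.pi fun _ => P])
  set N : ℝ := (Fintype.card ι : ℝ)
  have hN : 0 < N := Nat.cast_pos.2 Fintype.card_pos
  have hm : (1 : ℝ) ≤ m := Nat.one_le_cast.2 (NeZero.one_le)
  have hm0 : (0 : ℝ) < m := by linarith
  have hh2 : MemLp h 2 (iidLaw m P) := hh.mono_exponent (by norm_num)
  have hkn := kernelNorm_nonneg (P := P) (h := h)
  have hc1 : ∑ q ∈ K, c q = 1 := by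
    have h1 := sum_weights_eq hκ hw
    have h2 : N * (m / N) = m := by field_simp
    rw [h2] at h1
    exact mul_left_cancel₀ hm0.ne' (by rw [h1, mul_one])
  have hvar := sq_sigmaOne_le_variance_weightedUStat (K := K) (κ := κ) (c := c) hmeas hsym hh2 hκ hc1
  have hs : m * sigmaOne P h / √N ≤ s := by
    refine Real.le_sqrt_of_sq_le (le_trans (le_of_eq ?_) hvar)
    rw [div_pow, mul_pow, Real.sq_sqrt hN.le]
  have hs0 : 0 < s := lt_of_lt_of_le (by positivity) hs
  have hs2 : s ^ 2 = Var[weightedUStat K κ c h; Measure.pi fun _ => P] :=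
    Real.sq_sqrt (variance_nonneg _ _)
  have hU : MemLp (weightedUStat K κ c h) 4 (Measure.pi fun _ => P) := memLp_weightedUStat hκ hh
  have hU2 : MemLp (weightedUStat K κ c h) 2 (Measure.pi fun _ => P) :=
    hU.mono_exponent (by norm_num)
  have hmean : ∫ x, weightedUStat K κ c h x ∂(Measure.pi fun _ => P) = theta P h := by
    rw [integral_weightedUStat hκ (hh2.integrable one_le_two), hc1, one_mul]
  let F : (ι → ℝ) → ℝ := fun x => (weightedUStat K κ c h x - theta P h) / s
  have hF : MemLp F 4 (Measure.pi fun _ => P) := by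
    have h1 : MemLp (fun x => weightedUStat K κ c h x - theta P h) 4 (Measure.pi fun _ => P) :=
      hU.sub (memLp_const _)
    have h2 := h1.const_mul s⁻¹
    have h3 : F = fun x => s⁻¹ * (weightedUStat K κ c h x - theta P h) := by
      funext x; simp only [F, div_eq_inv_mul]
    rw [h3]
    exact h2
  have hF0 : ∫ x, F x ∂(Measure.pi fun _ => P) = 0 := by
    simp only [F]
    rw [integral_div, integral_sub (hU2.integrable one_le_two) (integrable_const _), hmean]
    simp
  have hF1 : ∫ x, F x ^ 2 ∂(Measure.pi fun _ => P) = 1 := by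
    simp only [F, div_pow]
    rw [integral_div, hs2, variance_eq_integral hU.1.aemeasurable, hmean, div_self]
    rw [variance_eq_integral hU.1.aemeasurable, hmean] at hs2
    rw [← hs2]; positivity
  -- Standardization is absorbed into the weights `c q / s`; the centring constant drops out of all
  -- differences.
  have hFw : ∀ x, F x = weightedUStat K κ (fun q => c q / s) h x - theta P h / s := by
    intro x
    simp only [F, weightedUStat, sub_div, Finset.sum_div]
    congr 1
    exact Finset.sum_congr rfl fun q _ => by ring
  have hcs : ∀ q ∈ K, 0 ≤ c q / s := fun q hq => div_nonneg (hc q hq) hs0.le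
  have hws : ∀ p, ∑ q ∈ K with p ∈ Finset.univ.image (κ q), c q / s = m / N / s := fun p => by
    rw [← Finset.sum_div, hw p]
  have hres : ∀ p, resampleDiff F p =
      resampleDiff (weightedUStat K κ (fun q => c q / s) h) p := fun p => by
    funext V; simp only [resampleDiff, hFw]; ring
  have hmix : ∀ p p', mixDiff F p p' =
      mixDiff (weightedUStat K κ (fun q => c q / s) h) p p' := fun p p' => by
    funext V; simp only [mixDiff, hFw]; ring
  have ha : ∀ p, eLpNorm (resampleDiff F p) 4 (Measure.pi fun _ => P.prod P) ≤
      ((m / N / s * (2 * kernelNorm P h 4)).toNNReal : ENNReal) := fun p => by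
    rw [hres, ← hws p]
    exact eLpNorm_resampleDiff_weightedUStat_le hh hκ hcs p
  have hb : ∀ p p', p ≠ p' → eLpNorm (mixDiff F p p') 4 (Measure.pi fun _ => P.prod P) ≤
      (((∑ q ∈ K with p ∈ Finset.univ.image (κ q) ∧ p' ∈ Finset.univ.image (κ q), c q / s) *
        (4 * kernelNorm P h 4)).toNNReal : ENNReal) := fun p p' _ => by
    rw [hmix]
    exact eLpNorm_mixDiff_weightedUStat_le hh hκ hcs p p'
  have hβ : ∀ l, ∑ p ∈ Finset.univ.erase l, ((∑ q ∈ K with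
      p ∈ Finset.univ.image (κ q) ∧ l ∈ Finset.univ.image (κ q), c q / s) *
        (4 * kernelNorm P h 4)).toNNReal ≤
      ((m - 1) * (m / N / s) * (4 * kernelNorm P h 4)).toNNReal := fun l => by
    rw [← Real.toNNReal_sum_of_nonneg, ← Finset.sum_mul, sum_pair_weights_eq hκ hws]
    intro p _
    exact mul_nonneg (Finset.sum_nonneg fun q hq => hcs q (Finset.mem_filter.1 hq).1)
      (by positivity)
  refine (abs_measure_sub_Phi_le hF hF0 hF1 ha hb hβ z).trans ?_
  have hm1 : 0 ≤ (m : ℝ) - 1 := by linarith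
  rw [Real.coe_toNNReal _ (by positivity), Real.coe_toNNReal _ (by positivity)]
  set ρ := kernelNorm P h 4 / sigmaOne P h
  have hρ : 1 ≤ ρ := (one_le_div hσ).2 (sigmaOne_le_kernelNorm hmeas hh)
  -- The lower bound `s ≥ m σ₁ / √N` from the Hájek projection enters here.
  have hv : m / N / s * kernelNorm P h 4 ≤ ρ / √N := by
    have hsq : √N * √N = N := Real.mul_self_sqrt hN.le
    have hsN : 0 < √N := Real.sqrt_pos.2 hN
    rw [div_div, div_mul_eq_mul_div, div_le_div_iff₀ (by positivity) hsN]
    have h1 : m * sigmaOne P h ≤ s * √N := (div_le_iff₀ hsN).1 hs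
    calc m * kernelNorm P h 4 * √N = ρ * (m * sigmaOne P h) * √N := by
          simp only [ρ]; field_simp
      _ ≤ ρ * (s * √N) * √N := by gcongr
      _ = ρ * (√N * √N * s) := by ring
      _ = ρ * (N * s) := by rw [hsq]
  set v := m / N / s * kernelNorm P h 4
  have hv0 : 0 ≤ v := by positivity
  -- Here `a = 2v` and `β = 4(m - 1)v`, so `a + β = (4m - 2)v ≤ 4mv`, and `6 · 2 · 4 = 48`.
  calc 6 * (√N * (m / N / s * (2 * kernelNorm P h 4) * (m / N / s * (2 * kernelNorm P h 4) +
        (m - 1) * (m / N / s) * (4 * kernelNorm P h 4))))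
      = 6 * (√N * (2 * v * ((4 * m - 2) * v))) := by simp only [v]; ring
    _ ≤ 6 * (√N * (2 * (ρ / √N) * ((4 * m) * (ρ / √N)))) := by
        have : 0 ≤ 4 * (m : ℝ) - 2 := by linarith
        gcongr
        linarith
    _ = 48 * m / √N * ρ ^ 2 := by
        have hsN : 0 < √N := Real.sqrt_pos.2 hN
        field_simp; ring
    -- The argument yields `ρ²`; since `ρ ≥ 1`, it is relaxed to the cube.
    _ ≤ 48 * m / √N * ρ ^ 3 := by
        gcongr 48 * (m : ℝ) / √N * ?_
        exact pow_le_pow_right₀ hρ (by norm_num)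
    _ = _ := by simp only [ρ, div_pow]

end WeightedUStatBound

/-! ### Counting increasing tuples through a given index -/

section Counting

open Classical in
/-- Increasing `m`-tuples correspond to sets with `m` elements. -/
lemma card_strictMono_filter {m n : ℕ} (p : Finset (Fin n) → Prop) [DecidablePred p] :
    ((Finset.univ.filter fun j : Fin m → Fin n => StrictMono j).filter
      fun j => p (Finset.univ.image j)).card =
      ((Finset.powersetCard m (Finset.univ : Finset (Fin n))).filter p).card := by
  refine Finset.card_bij (fun j _ => Finset.univ.image j) ?_ ?_ ?_
  · intro j hj
    simp only [Finset.mem_filter, Finset.mem_univ, true_and] at hj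
    simp only [Finset.mem_filter, Finset.mem_powersetCard, Finset.subset_univ, true_and]
    exact ⟨by rw [Finset.card_image_of_injective _ hj.1.injective, Finset.card_univ,
      Fintype.card_fin], hj.2⟩
  · intro j hj j' hj' heq
    simp only [Finset.mem_filter, Finset.mem_univ, true_and] at hj hj'
    have hcard : (Finset.univ.image j).card = m := by
      rw [Finset.card_image_of_injective _ hj.1.injective, Finset.card_univ, Fintype.card_fin]
    exact (Finset.orderEmbOfFin_unique hcard
      (fun l => Finset.mem_image_of_mem _ (Finset.mem_univ l)) hj.1).trans
      (Finset.orderEmbOfFin_unique hcard (fun l => (congrArg (j' l ∈ ·) heq).mpr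
        (Finset.mem_image_of_mem _ (Finset.mem_univ l))) hj'.1).symm
  · intro s hs
    simp only [Finset.mem_filter, Finset.mem_powersetCard, Finset.subset_univ, true_and] at hs
    have himg : Finset.univ.image (s.orderEmbOfFin hs.1) = s :=
      Finset.image_orderEmbOfFin_univ s hs.1
    refine ⟨s.orderEmbOfFin hs.1, ?_, himg⟩
    simp only [Finset.mem_filter, Finset.mem_univ, true_and]
    exact ⟨(s.orderEmbOfFin hs.1).strictMono, by rw [himg]; exact hs.2⟩

lemma card_powersetCard_filter_mem {m n : ℕ} (j₀ : Fin (n + 1)) :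
    ((Finset.powersetCard (m + 1) (Finset.univ : Finset (Fin (n + 1)))).filter
      fun s => j₀ ∈ s).card = n.choose m := by
  have h1 := Finset.card_filter_add_card_filter_not (s :=
    Finset.powersetCard (m + 1) (Finset.univ : Finset (Fin (n + 1)))) (fun s => j₀ ∈ s)
  have h2 : (Finset.powersetCard (m + 1) (Finset.univ : Finset (Fin (n + 1)))).filter
      (fun s => j₀ ∉ s) = Finset.powersetCard (m + 1) (Finset.univ.erase j₀) := by
    ext s
    simp only [Finset.mem_filter, Finset.mem_powersetCard, Finset.subset_univ, true_and,
      Finset.subset_erase]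
    tauto
  rw [h2, Finset.card_powersetCard, Finset.card_powersetCard, Finset.card_erase_of_mem
    (Finset.mem_univ _), Finset.card_univ, Fintype.card_fin, Nat.add_sub_cancel,
    Nat.choose_succ_succ'] at h1
  omega

open Classical in
/-- Each index belongs to a fraction `m / n` of the increasing `m`-tuples. -/
lemma mul_card_strictMono_mem {m n : ℕ} [NeZero m] (j₀ : Fin n) :
    n * ((Finset.univ.filter fun j : Fin m → Fin n => StrictMono j).filter
      fun j => j₀ ∈ Finset.univ.image j).card = m * n.choose m := by
  obtain ⟨m, rfl⟩ := Nat.exists_eq_succ_of_ne_zero (NeZero.ne m)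
  obtain ⟨n, rfl⟩ := Nat.exists_eq_succ_of_ne_zero (Fin.pos j₀).ne'
  have h0 := card_strictMono_filter (m := m + 1) (fun s : Finset (Fin (n + 1)) => j₀ ∈ s)
  have h := card_powersetCard_filter_mem (m := m) j₀
  have h2 := Nat.add_one_mul_choose_eq n m
  simp only [Nat.succ_eq_add_one] at *
  rw [mul_comm (m + 1), ← h2, ← h, ← h0]

end Counting

/-! ### The distributed U-statistic as a weighted U-statistic -/

section Distributed

variable {m k : ℕ} {n : Fin k → ℕ}

open Classical in
/-- The increasing index tuples inside the blocks. -/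
noncomputable def blockTuples (m : ℕ) (n : Fin k → ℕ) : Finset ((i : Fin k) × (Fin m → Fin (n i))) :=
  Finset.univ.sigma fun _ => Finset.univ.filter fun j => StrictMono j

/-- An index tuple in a block as a tuple of indices of the whole sample. -/
def blockIndex (q : (i : Fin k) × (Fin m → Fin (n i))) (l : Fin m) : (i : Fin k) × Fin (n i) :=
  ⟨q.1, q.2 l⟩

/-- The weight of an index tuple in the distributed U-statistic. -/
noncomputable def blockWeight (q : (i : Fin k) × (Fin m → Fin (n i))) : ℝ :=
  n q.1 / totalSize n * (((n q.1).choose m : ℕ) : ℝ)⁻¹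

lemma distributedUStat_eq_weightedUStat (h : (Fin m → ℝ) → ℝ) (x : (i : Fin k) × Fin (n i) → ℝ) :
    distributedUStat h (fun i j => x ⟨i, j⟩) =
      weightedUStat (blockTuples m n) blockIndex blockWeight h x := by
  unfold distributedUStat weightedUStat blockTuples uStat
  rw [Finset.sum_sigma, Finset.mul_sum]
  refine Finset.sum_congr rfl fun i _ => ?_
  rw [Finset.mul_sum, Finset.mul_sum, Finset.mul_sum]
  refine Finset.sum_congr rfl fun j _ => ?_
  have : x ∘ blockIndex ⟨i, j⟩ = fun l => x ⟨i, j l⟩ := rfl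
  rw [this, blockWeight]
  ring

lemma blockIndex_injective {q : (i : Fin k) × (Fin m → Fin (n i))} (hq : q ∈ blockTuples m n) :
    Function.Injective (blockIndex q) := by
  intro l l' hl
  simp only [blockTuples, Finset.mem_sigma, Finset.mem_filter, Finset.mem_univ, true_and] at hq
  simp only [blockIndex, Sigma.mk.injEq, heq_eq_eq, true_and] at hl
  exact hq.injective hl

lemma blockWeight_nonneg (q : (i : Fin k) × (Fin m → Fin (n i))) : 0 ≤ blockWeight q := by
  unfold blockWeight; positivity

/-- Only tuples of the block of `p` count, and a fraction `m / n_i` of them contain `p`. The block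
size cancels against the factor `n_i / N`. -/
lemma sum_blockWeight [NeZero m] (hn : ∀ i, m ≤ n i) (p : (i : Fin k) × Fin (n i)) :
    ∑ q ∈ blockTuples m n with p ∈ Finset.univ.image (blockIndex q), blockWeight q =
      (m : ℝ) / totalSize n := by
  classical
  obtain ⟨i₀, j₀⟩ := p
  have hpos : 0 < (n i₀).choose m := Nat.choose_pos (hn i₀)
  have hcard := mul_card_strictMono_mem (m := m) j₀
  rw [Finset.sum_filter, blockTuples, Finset.sum_sigma, Finset.sum_eq_single i₀]
  · have hiff : ∀ j : Fin m → Fin (n i₀), (⟨i₀, j₀⟩ : (i : Fin k) × Fin (n i)) ∈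
        Finset.univ.image (blockIndex (n := n) ⟨i₀, j⟩) ↔ j₀ ∈ Finset.univ.image j := by
      intro j; simp [blockIndex]
    simp_rw [hiff]
    rw [← Finset.sum_filter]
    simp only [blockWeight]
    rw [Finset.sum_const, nsmul_eq_mul]
    have hcard' : (n i₀ : ℝ) * (((Finset.univ.filter fun j : Fin m → Fin (n i₀) =>
        StrictMono j).filter fun j => j₀ ∈ Finset.univ.image j).card : ℝ) =
        m * (n i₀).choose m := by exact_mod_cast hcard
    have hpos' : ((n i₀).choose m : ℝ) ≠ 0 := by positivity
    rw [div_mul_eq_mul_div, mul_div_assoc', ← mul_assoc, mul_comm _ (n i₀ : ℝ), hcard']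
    field_simp
  · intro i _ hi
    refine Finset.sum_eq_zero fun j _ => if_neg ?_
    simp only [Finset.mem_image, Finset.mem_univ, true_and, not_exists, blockIndex]
    intro l hl
    exact hi (congrArg Sigma.fst hl)
  · intro h; exact absurd (Finset.mem_univ _) h

lemma card_sample : Fintype.card ((i : Fin k) × Fin (n i)) = totalSize n := by
  simp [totalSize]

/-- The law of the whole sample. -/
lemma map_sample {Ω : Type*} [MeasurableSpace Ω] {μ : Measure Ω} [IsProbabilityMeasure μ]
    {P : Measure ℝ} {X : (i : Fin k) → Fin (n i) → Ω → ℝ} (hX : ∀ i j, HasLaw (X i j) P μ)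
    (hind : iIndepFun (fun p : (i : Fin k) × Fin (n i) => X p.1 p.2) μ) :
    μ.map (fun ω (p : (i : Fin k) × Fin (n i)) => X p.1 p.2 ω) = Measure.pi fun _ => P := by
  have h := (iIndepFun_iff_map_fun_eq_pi_map (f := fun p : (i : Fin k) × Fin (n i) => X p.1 p.2)
    fun p => (hX p.1 p.2).aemeasurable).1 hind
  simp_rw [fun p : (i : Fin k) × Fin (n i) => (hX p.1 p.2).map_eq] at h
  exact h

end Distributed

end DistributedUStat

open DistributedUStat in
theorem theorem3p2 :
    ∃ C : ℝ, 0 < C ∧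
      ∀ (m : ℕ) [NeZero m] (k : ℕ) (_ : 0 < k) (n : Fin k → ℕ) (_ : ∀ i, m ≤ n i)
        (P : Measure ℝ) [IsProbabilityMeasure P]
        (h : (Fin m → ℝ) → ℝ) (_ : Measurable h) (_ : IsSymmetricKernel h)
        (_ : Integrable (fun y => h y ^ 4) (iidLaw m P)) (_ : 0 < sigmaOne P h)
        (Ω : Type*) [MeasurableSpace Ω] (μ : Measure Ω) [IsProbabilityMeasure μ]
        (X : (i : Fin k) → Fin (n i) → Ω → ℝ)
        (_ : ∀ i j, HasLaw (X i j) P μ)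
        (_ : iIndepFun (fun p : (i : Fin k) × Fin (n i) => X p.1 p.2) μ)
        (z : ℝ),
        |μ.real {ω | normalizedStat P h X ω / √(Var[normalizedStat P h X; μ]) ≤ z} - Phi z|
          ≤ C * (m : ℝ) / √(totalSize n : ℝ) * (kernelNorm P h 4 ^ 3 / sigmaOne P h ^ 3) := by
  refine ⟨48, by norm_num, ?_⟩
  intro m _ k hk n hn P _ h hmeas hsym hint hσ Ω _ μ _ X hX hind z
  have hh4 : MemLp h 4 (iidLaw m P) := memLp_four_of_integrable_pow hmeas.aestronglyMeasurable hint
  have hnpos : ∀ i, 0 < n i := fun i => (NeZero.pos m).trans_le (hn i)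
  have : Nonempty ((i : Fin k) × Fin (n i)) := ⟨⟨⟨0, hk⟩, ⟨0, hnpos _⟩⟩⟩
  have hN : 0 < totalSize n := by rw [← card_sample]; exact Fintype.card_pos
  have key := weightedUStat_berryEsseen (K := blockTuples m n) (κ := blockIndex)
    (c := blockWeight) hh4 hmeas hsym hσ (fun q hq => blockIndex_injective hq)
    (fun q _ => blockWeight_nonneg q)
    (fun p => by rw [card_sample]; exact sum_blockWeight hn p) z
  rw [card_sample] at key
  set U := weightedUStat (blockTuples m n) blockIndex blockWeight h
  set A : ℝ := √(totalSize n : ℝ) / ((m : ℝ) * sigmaOne P h)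
  have hA : 0 < A := by
    have : (0 : ℝ) < m := Nat.cast_pos.2 (NeZero.pos m)
    have : (0 : ℝ) < totalSize n := Nat.cast_pos.2 hN
    positivity
  set Y : Ω → (i : Fin k) × Fin (n i) → ℝ := fun ω p => X p.1 p.2 ω
  have hY : AEMeasurable Y μ := aemeasurable_pi_lambda _ fun p => (hX p.1 p.2).aemeasurable
  have hmap : μ.map Y = Measure.pi fun _ => P := map_sample hX hind
  have hUm : Measurable U := measurable_weightedUStat hmeas
  have hstat : normalizedStat P h X = fun ω => A * (U (Y ω) - theta P h) := by
    funext ω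
    rw [normalizedStat]
    congr 2
    exact distributedUStat_eq_weightedUStat h (Y ω)
  have hvar : Var[normalizedStat P h X; μ] = A ^ 2 * Var[U; Measure.pi fun _ => P] := by
    rw [hstat, variance_const_mul, ← hmap, variance_map hUm.aemeasurable hY]
    congr 1
    exact variance_sub_const (hUm.comp_aemeasurable hY).aestronglyMeasurable _
  -- The positive factor `A` cancels between the statistic and its standard deviation, so the event
  -- depends on the sample only through the standardized U-statistic.
  have hset : {ω | normalizedStat P h X ω / √(Var[normalizedStat P h X; μ]) ≤ z} =
      Y ⁻¹' {x | (U x - theta P h) / √(Var[U; Measure.pi fun _ => P]) ≤ z} := by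
    ext ω
    simp only [Set.mem_ofPred_eq, Set.mem_preimage]
    rw [hvar, hstat, Real.sqrt_mul (sq_nonneg A), Real.sqrt_sq hA.le,
      mul_div_mul_left _ _ hA.ne']
  have hmeasSet : MeasurableSet {x | (U x - theta P h) / √(Var[U; Measure.pi fun _ => P]) ≤ z} :=
    measurableSet_le ((hUm.sub_const _).div_const _) measurable_const
  rw [hset, ← map_measureReal_apply_of_aemeasurable hY hmeasSet, hmap]
  exact key
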